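/- Let $(\widetilde M, g, J)$ be a Kähler manifold of real dimension $2m$ with Levi-Civita connection $\widetilde\nabla$ (so $J^2=-1$, $g(JX,JY)=g(X,Y)$, $\widetilde\nabla J=0$), and let $M$ be an $n$-dimensional ($n>1$) smooth immersed submanifold of $\widetilde M$ with the induced metric. Let $\sigma$ be the second fundamental form of $M$ (the normal component of $\widetilde\nabla_XY$), $H=\frac1n\operatorname{tr}\sigma$ its mean curvature vector, $D$ the normal connection (the normal component of $\widetilde\nabla_X\xi$), $R^\perp(X,Y)\xi=D_XD_Y\xi-D_YD_X\xi-D_{[X,Y]}\xi$ its curvature tensor, and let $f\xi$ denote the normal component of $J\xi$ for normal vector fields $\xi$. Assume that 1. $M$ is totally real: $J\,T_pM\subset (T_pM)^\perp$ for every $p\in M$; 2. the $f$-structure in the normal bundle is parallel: $D_X(f\xi)=f(D_X\xi)$ for all smooth tangent vector fields $X$ and all smooth normal vector fields $\xi$ of $M$ (in particular $f=0$ is allowed); 3. $M$ has constant sectional curvature $c$ for some constant $c\in\mathbb R$; 4. the mean curvature vector is semiparallel: $R^\perp(X,Y)H=0$ for all smooth tangent vector fields $X,Y$ of $M$. Then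 $M$ is minimal ($H=0$ everywhere) or flat (its sectional curvature vanishes identically). -/

import Mathlib

open Bundle VectorField Module
open scoped Manifold ContDiff

noncomputable section

namespace TotallyReal

section LeviCivita

variable {E : Type*} [NormedAddCommGroup E] [NormedSpace ℝ E] [FiniteDimensional ℝ E] [CompleteSpace E]
  {M : Type*} [TopologicalSpace M] [ChartedSpace E M] [IsManifold 𝓘(ℝ, E) ∞ M]
  [RiemannianBundle (fun x : M ↦ TangentSpace 𝓘(ℝ, E) x)]
  [IsContMDiffRiemannianBundle 𝓘(ℝ, E) ∞ E (fun x : M ↦ TangentSpace 𝓘(ℝ, E) x)]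

/-- The function `x ↦ g(X, Y)(x)` for two vector fields on a Riemannian manifold. -/
def metric (X Y : Π x : M, TangentSpace 𝓘(ℝ, E) x) (x : M) : ℝ := inner ℝ (X x) (Y x)

/-- The right-hand side of the Koszul formula for `2 g(∇_X Y, Z)`:
`X g(Y,Z) + Y g(Z,X) - Z g(X,Y) - g(Y,[X,Z]) - g(Z,[Y,X]) + g(X,[Z,Y])`. -/
def koszul (Y X Z : Π x : M, TangentSpace 𝓘(ℝ, E) x) (x : M) : ℝ :=
  mvfderiv 𝓘(ℝ, E) (metric Y Z) x (X x) + mvfderiv 𝓘(ℝ, E) (metric Z X) x (Y x)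
    - mvfderiv 𝓘(ℝ, E) (metric X Y) x (Z x)
    - inner ℝ (Y x) (mlieBracket 𝓘(ℝ, E) X Z x) - inner ℝ (Z x) (mlieBracket 𝓘(ℝ, E) Y X x)
    + inner ℝ (X x) (mlieBracket 𝓘(ℝ, E) Z Y x)

variable {x : M} {X Y Z : Π x : M, TangentSpace 𝓘(ℝ, E) x}
lemma mdiffAt_metric (hX : MDiffAt (T% X) x) (hY : MDiffAt (T% Y) x) :
    MDiffAt (metric X Y) x := MDifferentiableAt.inner_bundle hX hY

lemma koszul_tensorial_left (hY : MDiffAt (T% Y) x) (hZ : MDiffAt (T% Z) x) :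
    TensorialAt 𝓘(ℝ, E) E (fun X => koszul Y X Z x) x where
  smul {f X} hf hX := by
    have h1 : metric Z (f • X) = f * metric Z X := by
      ext y; simp [metric, inner_smul_right]
    have h2 : metric (f • X) Y = f * metric X Y := by
      ext y; simp [metric, inner_smul_left]
    simp only [koszul, h1, h2]
    rw [mvfderiv_mul hf (mdiffAt_metric hZ hX), mvfderiv_mul hf (mdiffAt_metric hX hY),
      mlieBracket_smul_left hf hX, mlieBracket_smul_right hf hX]
    simp [inner_smul_right, inner_smul_left, inner_add_right, metric]
    rw [real_inner_comm (Y x) (X x)]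
    ring
  add {X X'} hX hX' := by
    have h1 : metric Z (X + X') = metric Z X + metric Z X' := by
      ext y; simp [metric, inner_add_right]
    have h2 : metric (X + X') Y = metric X Y + metric X' Y := by
      ext y; simp [metric, inner_add_left]
    simp only [koszul, h1, h2]
    rw [mvfderiv_add (mdiffAt_metric hZ hX) (mdiffAt_metric hZ hX'), mvfderiv_add (mdiffAt_metric hX hY) (mdiffAt_metric hX' hY),
      mlieBracket_add_left hX hX', mlieBracket_add_right hX hX']
    simp [inner_add_right, inner_add_left]
    ring

lemma koszul_tensorial_right (hY : MDiffAt (T% Y) x) (hX : MDiffAt (T% X) x) :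
    TensorialAt 𝓘(ℝ, E) E (fun Z => koszul Y X Z x) x where
  smul {f Z} hf hZ := by
    have h1 : metric Y (f • Z) = f * metric Y Z := by
      ext y; simp [metric, inner_smul_right]
    have h2 : metric (f • Z) X = f * metric Z X := by
      ext y; simp [metric, inner_smul_left]
    simp only [koszul, h1, h2]
    rw [mvfderiv_mul hf (mdiffAt_metric hY hZ), mvfderiv_mul hf (mdiffAt_metric hZ hX),
      mlieBracket_smul_left hf hZ, mlieBracket_smul_right hf hZ]
    simp [inner_smul_right, inner_smul_left, inner_add_right, metric]
    rw [real_inner_comm (X x) (Z x)]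
    ring
  add {Z Z'} hZ hZ' := by
    have h1 : metric Y (Z + Z') = metric Y Z + metric Y Z' := by
      ext y; simp [metric, inner_add_right]
    have h2 : metric (Z + Z') X = metric Z X + metric Z' X := by
      ext y; simp [metric, inner_add_left]
    simp only [koszul, h1, h2]
    rw [mvfderiv_add (mdiffAt_metric hY hZ) (mdiffAt_metric hY hZ'),
      mvfderiv_add (mdiffAt_metric hZ hX) (mdiffAt_metric hZ' hX),
      mlieBracket_add_left hZ hZ', mlieBracket_add_right hZ hZ']
    simp [inner_add_right, inner_add_left]
    ring

lemma koszul_add {Y' : Π x : M, TangentSpace 𝓘(ℝ, E) x} (hX : MDiffAt (T% X) x)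
    (hZ : MDiffAt (T% Z) x) (hY : MDiffAt (T% Y) x) (hY' : MDiffAt (T% Y') x) :
    koszul (Y + Y') X Z x = koszul Y X Z x + koszul Y' X Z x := by
  have h1 : metric (Y + Y') Z = metric Y Z + metric Y' Z := by
    ext y; simp [metric, inner_add_left]
  have h2 : metric X (Y + Y') = metric X Y + metric X Y' := by
    ext y; simp [metric, inner_add_right]
  simp only [koszul, h1, h2]
  rw [mvfderiv_add (mdiffAt_metric hY hZ) (mdiffAt_metric hY' hZ),
    mvfderiv_add (mdiffAt_metric hX hY) (mdiffAt_metric hX hY'),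
    mlieBracket_add_left hY hY', mlieBracket_add_right hY hY']
  simp [inner_add_right, inner_add_left]
  ring

lemma koszul_smul {f : M → ℝ} (hX : MDiffAt (T% X) x)
    (hZ : MDiffAt (T% Z) x) (hf : MDiffAt f x) (hY : MDiffAt (T% Y) x) :
    koszul (f • Y) X Z x = f x * koszul Y X Z x
      + 2 * (mvfderiv 𝓘(ℝ, E) f x (X x) * inner ℝ (Y x) (Z x)) := by
  have h1 : metric (f • Y) Z = f * metric Y Z := by
    ext y; simp [metric, inner_smul_left]
  have h2 : metric X (f • Y) = f * metric X Y := by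
    ext y; simp [metric, inner_smul_right]
  simp only [koszul, h1, h2]
  rw [mvfderiv_mul hf (mdiffAt_metric hY hZ), mvfderiv_mul hf (mdiffAt_metric hX hY),
    mlieBracket_smul_left hf hY, mlieBracket_smul_right hf hY]
  simp [inner_smul_right, inner_smul_left, inner_add_right, metric]
  rw [real_inner_comm (Y x) (Z x)]
  ring

instance (x : M) : FiniteDimensional ℝ (TangentSpace 𝓘(ℝ, E) x) :=
  inferInstanceAs (FiniteDimensional ℝ E)

open Classical in
/-- The Levi-Civita connection as a function: `∇_X Y` at `x` is the vector `w` of `T_x M` such that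
`2 g(w, Z x)` is the Koszul expression (junk value `0` where `Y` is not differentiable). Mathlib's
argument order: `leviCivitaFun Y x v` is `∇_v Y`. -/
def leviCivitaFun (Y : Π x : M, TangentSpace 𝓘(ℝ, E) x) (x : M) :
    TangentSpace 𝓘(ℝ, E) x →L[ℝ] TangentSpace 𝓘(ℝ, E) x :=
  if hY : MDiffAt (T% Y) x then
    LinearMap.toContinuousLinearMap
      { toFun := fun v ↦ (1 / 2 : ℝ) •
          (InnerProductSpace.toDual ℝ (TangentSpace 𝓘(ℝ, E) x)).symm
            (TensorialAt.mkHom₂ (fun X Z ↦ koszul Y X Z x) x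
              (fun _ hZ ↦ koszul_tensorial_left hY hZ) (fun _ hX ↦ koszul_tensorial_right hY hX) v)
        map_add' := fun v w ↦ by simp
        map_smul' := fun c v ↦ by simp [smul_comm c] }
  else 0

lemma inner_leviCivitaFun (hX : MDiffAt (T% X) x) (hY : MDiffAt (T% Y) x) (hZ : MDiffAt (T% Z) x) :
    inner ℝ (leviCivitaFun Y x (X x)) (Z x) = 1 / 2 * koszul Y X Z x := by
  rw [leviCivitaFun, dif_pos hY]
  simp [inner_smul_left, TensorialAt.mkHom₂_apply _ _ hX hZ]


lemma eq_of_inner {v w : TangentSpace 𝓘(ℝ, E) x}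
    (h : ∀ z : TangentSpace 𝓘(ℝ, E) x, inner ℝ v z = inner ℝ w z) : v = w :=
  ext_inner_right ℝ h

lemma leviCivitaFun_isCov : IsCovariantDerivativeOn (I := 𝓘(ℝ, E)) (M := M) E
    (V := fun x : M ↦ TangentSpace 𝓘(ℝ, E) x) leviCivitaFun Set.univ where
  add {Y Y' x} hY hY' _ := by
    ext v
    refine eq_of_inner fun z ↦ ?_
    have hX := FiberBundle.mdifferentiableAt_extend 𝓘(ℝ, E) E v
    have hZ := FiberBundle.mdifferentiableAt_extend 𝓘(ℝ, E) E z
    have h := inner_leviCivitaFun hX (mdifferentiableAt_add_section hY hY') hZ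
    have h1 := inner_leviCivitaFun hX hY hZ
    have h2 := inner_leviCivitaFun hX hY' hZ
    rw [koszul_add hX hZ hY hY'] at h
    simp only [FiberBundle.extend_apply_self] at h h1 h2
    rw [h, add_apply, inner_add_left, h1, h2]
    ring
  leibniz {Y f x} hY hf _ := by
    ext v
    refine eq_of_inner fun z ↦ ?_
    have hX := FiberBundle.mdifferentiableAt_extend 𝓘(ℝ, E) E v
    have hZ := FiberBundle.mdifferentiableAt_extend 𝓘(ℝ, E) E z
    have h := inner_leviCivitaFun hX (hf.smul_section hY) hZ
    have h1 := inner_leviCivitaFun hX hY hZ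
    rw [koszul_smul hX hZ hf hY] at h
    simp only [FiberBundle.extend_apply_self] at h h1
    rw [h]
    simp [inner_add_left, inner_smul_left, h1]
    ring

variable (E M) in
/-- The Levi-Civita connection of a Riemannian manifold `M`; `leviCivita E M Y x v` is `∇_v Y`. -/
def leviCivita : CovariantDerivative 𝓘(ℝ, E) E (fun x : M ↦ TangentSpace 𝓘(ℝ, E) x) where
  toFun := leviCivitaFun
  isCovariantDerivativeOnUniv := leviCivitaFun_isCov

/-- The Levi-Civita connection is torsion free. -/
theorem leviCivita_torsion : (leviCivita E M).torsion = 0 := by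
  rw [CovariantDerivative.torsion_eq_zero_iff]
  intro X Y x hX hY
  refine eq_of_inner fun z ↦ ?_
  have hZ := FiberBundle.mdifferentiableAt_extend 𝓘(ℝ, E) E z
  have h1 := inner_leviCivitaFun hX hY hZ
  have h2 := inner_leviCivitaFun hY hX hZ
  simp only [FiberBundle.extend_apply_self] at h1 h2
  rw [inner_sub_left]
  erw [h1, h2]
  have hs : ∀ A B : Π x : M, TangentSpace 𝓘(ℝ, E) x, metric A B = metric B A := by
    intro A B; ext y; exact real_inner_comm _ _
  set Z := FiberBundle.extend E z
  have hz : Z x = z := by simp [Z]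
  simp only [koszul]
  rw [hs Y Z, hs Z X, hs X Y, mlieBracket_swap_apply (V := Y) (W := X),
    mlieBracket_swap_apply (V := Z) (W := Y), mlieBracket_swap_apply (V := Z) (W := X), hz,
    real_inner_comm z]
  simp
  ring

/-- The Levi-Civita connection is compatible with the metric. -/
theorem leviCivita_metric (hY : MDiffAt (T% Y) x) (hZ : MDiffAt (T% Z) x)
    (v : TangentSpace 𝓘(ℝ, E) x) :
    mvfderiv 𝓘(ℝ, E) (fun y ↦ inner ℝ (Y y) (Z y)) x v =
      inner ℝ (leviCivita E M Y x v) (Z x) + inner ℝ (Y x) (leviCivita E M Z x v) := by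
  have hX := FiberBundle.mdifferentiableAt_extend 𝓘(ℝ, E) E v
  have h1 := inner_leviCivitaFun hX hY hZ
  have h2 := inner_leviCivitaFun hX hZ hY
  have hv : FiberBundle.extend E v x = v := by simp
  set X := FiberBundle.extend E v
  change mvfderiv 𝓘(ℝ, E) (metric Y Z) x v = inner ℝ (leviCivitaFun Y x v) (Z x) +
    inner ℝ (Y x) (leviCivitaFun Z x v)
  rw [← hv, real_inner_comm (leviCivitaFun Z x (X x)), h1, h2]
  have hs : ∀ A B : Π x : M, TangentSpace 𝓘(ℝ, E) x, metric A B = metric B A := by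
    intro A B; ext y; exact real_inner_comm _ _
  simp only [koszul]
  rw [hs Y Z, hs Z X, hs X Y, mlieBracket_swap_apply (V := Y) (W := X),
    mlieBracket_swap_apply (V := Z) (W := Y), mlieBracket_swap_apply (V := Z) (W := X)]
  simp
  ring

/-- `X` is a smooth vector field on `M`, i.e. `X ∈ 𝔛(M)`. -/
def IsSmoothField (X : Π x : M, TangentSpace 𝓘(ℝ, E) x) : Prop :=
  ContMDiff 𝓘(ℝ, E) 𝓘(ℝ, E).tangent ∞ (T% X)

/-- The curvature tensor `R(X,Y)Z = ∇_X ∇_Y Z - ∇_Y ∇_X Z - ∇_{[X,Y]} Z` at `x`. -/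
def curvature (X Y Z : Π x : M, TangentSpace 𝓘(ℝ, E) x) (x : M) : TangentSpace 𝓘(ℝ, E) x :=
  leviCivita E M (fun y ↦ leviCivita E M Z y (Y y)) x (X x)
    - leviCivita E M (fun y ↦ leviCivita E M Z y (X y)) x (Y x)
    - leviCivita E M Z x (mlieBracket 𝓘(ℝ, E) X Y x)

variable (E M) in
/-- `M` has constant (sectional) curvature `c`: for every point and every pair of tangent vectors
there, given as the values of smooth vector fields,
`g(R(X,Y)Y, X) = c (g(X,X) g(Y,Y) - g(X,Y)²)`. -/
def HasConstantCurvature (c : ℝ) : Prop :=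
  ∀ X Y : Π x : M, TangentSpace 𝓘(ℝ, E) x, IsSmoothField X → IsSmoothField Y →
    ∀ x : M, inner ℝ (curvature X Y Y x) (X x) =
      c * (inner ℝ (X x) (X x) * inner ℝ (Y x) (Y x) - inner ℝ (X x) (Y x) ^ 2)

variable (E M) in
/-- `M` is flat: its sectional curvature vanishes identically. -/
def IsFlat : Prop := HasConstantCurvature E M 0

/-- `J` is a Kähler structure on the Riemannian manifold `M`: a smooth almost complex structure
which is orthogonal and parallel for the Levi-Civita connection (hence integrable, with closed
fundamental form). -/
structure IsKaehler (J : Π x : M, TangentSpace 𝓘(ℝ, E) x →L[ℝ] TangentSpace 𝓘(ℝ, E) x) :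
    Prop where
  smooth : ContMDiff 𝓘(ℝ, E) (𝓘(ℝ, E).prod 𝓘(ℝ, E →L[ℝ] E)) ∞
    (fun x ↦ TotalSpace.mk' (E →L[ℝ] E)
      (E := fun x : M ↦ TangentSpace 𝓘(ℝ, E) x →L[ℝ] TangentSpace 𝓘(ℝ, E) x) x (J x))
  sq (x : M) (v : TangentSpace 𝓘(ℝ, E) x) : J x (J x v) = -v
  isometric (x : M) (v w : TangentSpace 𝓘(ℝ, E) x) : inner ℝ (J x v) (J x w) = inner ℝ v w
  parallel (Y : Π x : M, TangentSpace 𝓘(ℝ, E) x) (x : M) (hY : MDiffAt (T% Y) x)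
    (v : TangentSpace 𝓘(ℝ, E) x) :
    leviCivita E M (fun y ↦ J y (Y y)) x v = J x (leviCivita E M Y x v)

end LeviCivita

section Submanifold

variable {E : Type*} [NormedAddCommGroup E] [NormedSpace ℝ E] [FiniteDimensional ℝ E]
  [CompleteSpace E]
  {M : Type*} [TopologicalSpace M] [ChartedSpace E M] [IsManifold 𝓘(ℝ, E) ∞ M]
  [RiemannianBundle (fun x : M ↦ TangentSpace 𝓘(ℝ, E) x)]
  [IsContMDiffRiemannianBundle 𝓘(ℝ, E) ∞ E (fun x : M ↦ TangentSpace 𝓘(ℝ, E) x)]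
  {F : Type*} [NormedAddCommGroup F] [NormedSpace ℝ F] [FiniteDimensional ℝ F]
  [CompleteSpace F]
  {N : Type*} [TopologicalSpace N] [ChartedSpace F N] [IsManifold 𝓘(ℝ, F) ∞ N]
  [RiemannianBundle (fun x : N ↦ TangentSpace 𝓘(ℝ, F) x)]
  [IsContMDiffRiemannianBundle 𝓘(ℝ, F) ∞ F (fun x : N ↦ TangentSpace 𝓘(ℝ, F) x)]

variable (E F) in
/-- `ι : M → N` makes `M` an (immersed) Riemannian submanifold of `N`: it is smooth and the metric
of `M` is the one induced by `ι`. In particular each `dι_p` is injective. -/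
structure IsIsometricImmersion (ι : M → N) : Prop where
  smooth : ContMDiff 𝓘(ℝ, E) 𝓘(ℝ, F) ∞ ι
  isometric (p : M) (v w : TangentSpace 𝓘(ℝ, E) p) :
    inner ℝ (mfderiv 𝓘(ℝ, E) 𝓘(ℝ, F) ι p v) (mfderiv 𝓘(ℝ, E) 𝓘(ℝ, F) ι p w) = inner ℝ v w

/-- The covariant derivative `∇̃_v V` of a vector field `V` of `N` along `ι : M → N`, with `v ∈ T_p M`
(the connection induced on `ι^* TN` by the Levi-Civita connection of `N`). In the local
trivialization of `TN` at `ι p`, the field `V` has principal part `W : M → F`; the vector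
`∇̃_v V` has principal part `dW(v) + Γ(dι v, W p)`, where `Γ(dι v, W p)` is the derivative in
direction `dι v` of the vector field on `N` with constant principal part `W p`. -/
def covAlong (ι : M → N) (V : Π p : M, TangentSpace 𝓘(ℝ, F) (ι p)) (p : M)
    (v : TangentSpace 𝓘(ℝ, E) p) : TangentSpace 𝓘(ℝ, F) (ι p) :=
  let e := trivializationAt F (fun x : N ↦ TangentSpace 𝓘(ℝ, F) x) (ι p)
  let W : M → F := fun q ↦ (e ⟨ι q, V q⟩).2
  e.symm (ι p) (mvfderiv 𝓘(ℝ, E) W p v) +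
    leviCivita F N (FiberBundle.extend F (V p)) (ι p) (mfderiv 𝓘(ℝ, E) 𝓘(ℝ, F) ι p v)

variable (E) in
/-- `T_p M` as a subspace of `T_{ι p} N`. -/
def tangentImage (ι : M → N) (p : M) : Submodule ℝ (TangentSpace 𝓘(ℝ, F) (ι p)) :=
  LinearMap.range
    (mfderiv 𝓘(ℝ, E) 𝓘(ℝ, F) ι p : TangentSpace 𝓘(ℝ, E) p →ₗ[ℝ] TangentSpace 𝓘(ℝ, F) (ι p))

variable (E) in
/-- The normal component of a vector of `T_{ι p} N`. -/
def normalPart (ι : M → N) (p : M) (v : TangentSpace 𝓘(ℝ, F) (ι p)) :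
    TangentSpace 𝓘(ℝ, F) (ι p) :=
  (tangentImage E ι p)ᗮ.starProjection v

variable (E) in
/-- `ξ` is a smooth normal vector field, i.e. `ξ ∈ 𝔛(M)^⊥`. -/
structure IsSmoothNormalField (ι : M → N) (ξ : Π p : M, TangentSpace 𝓘(ℝ, F) (ι p)) : Prop where
  smooth : ContMDiff 𝓘(ℝ, E) 𝓘(ℝ, F).tangent ∞
    (fun p ↦ (⟨ι p, ξ p⟩ : TangentBundle 𝓘(ℝ, F) N))
  normal (p : M) : ξ p ∈ (tangentImage E ι p)ᗮ

/-- The normal connection `D_X ξ`, the normal component of `∇̃_X ξ`. -/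
def normalCov (ι : M → N) (X : Π p : M, TangentSpace 𝓘(ℝ, E) p)
    (ξ : Π p : M, TangentSpace 𝓘(ℝ, F) (ι p)) (p : M) : TangentSpace 𝓘(ℝ, F) (ι p) :=
  normalPart E ι p (covAlong ι ξ p (X p))

/-- The curvature of the normal connection,
`R^⊥(X,Y)ξ = D_X D_Y ξ - D_Y D_X ξ - D_{[X,Y]} ξ`. -/
def normalCurvature (ι : M → N) (X Y : Π p : M, TangentSpace 𝓘(ℝ, E) p)
    (ξ : Π p : M, TangentSpace 𝓘(ℝ, F) (ι p)) (p : M) : TangentSpace 𝓘(ℝ, F) (ι p) :=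
  normalCov ι X (normalCov ι Y ξ) p - normalCov ι Y (normalCov ι X ξ) p
    - normalCov ι (mlieBracket 𝓘(ℝ, E) X Y) ξ p

/-- The second fundamental form `σ(X,Y)`, the normal component of `∇̃_X Y`. -/
def secondFundamentalForm (ι : M → N) (X Y : Π p : M, TangentSpace 𝓘(ℝ, E) p) (p : M) :
    TangentSpace 𝓘(ℝ, F) (ι p) :=
  normalPart E ι p (covAlong ι (fun q ↦ mfderiv 𝓘(ℝ, E) 𝓘(ℝ, F) ι q (Y q)) p (X p))

variable (E F) in
/-- The mean curvature vector `H = (1/n) tr σ`: the trace is taken with respect to an orthonormal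
basis of `T_p M`, whose vectors are extended to vector fields to evaluate the tensor `σ`. -/
def meanCurvature (ι : M → N) (p : M) : TangentSpace 𝓘(ℝ, F) (ι p) :=
  (finrank ℝ E : ℝ)⁻¹ • ∑ i, secondFundamentalForm ι
    (FiberBundle.extend E (stdOrthonormalBasis ℝ (TangentSpace 𝓘(ℝ, E) p) i))
    (FiberBundle.extend E (stdOrthonormalBasis ℝ (TangentSpace 𝓘(ℝ, E) p) i)) p

variable (E F) in
/-- `M` is minimal: `H = 0`. -/
def IsMinimal (ι : M → N) : Prop := ∀ p : M, meanCurvature E F ι p = 0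

variable (E F) in
/-- The mean curvature vector is semiparallel: `R^⊥(X,Y)H = 0`. -/
def HasSemiparallelMeanCurvature (ι : M → N) : Prop :=
  ∀ X Y : Π p : M, TangentSpace 𝓘(ℝ, E) p, IsSmoothField X → IsSmoothField Y →
    ∀ p : M, normalCurvature ι X Y (meanCurvature E F ι) p = 0

variable (E) in
/-- `M` is totally real: `J T_p M ⊆ (T_p M)^⊥` for all `p`. -/
def IsTotallyReal (ι : M → N)
    (J : Π x : N, TangentSpace 𝓘(ℝ, F) x →L[ℝ] TangentSpace 𝓘(ℝ, F) x) : Prop :=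
  ∀ (p : M), ∀ v ∈ tangentImage E ι p, J (ι p) v ∈ (tangentImage E ι p)ᗮ

variable (E) in
/-- The endomorphism `f` of the normal bundle: `f ξ` is the normal component of `J ξ`. -/
def fStructure (ι : M → N)
    (J : Π x : N, TangentSpace 𝓘(ℝ, F) x →L[ℝ] TangentSpace 𝓘(ℝ, F) x)
    (ξ : Π p : M, TangentSpace 𝓘(ℝ, F) (ι p)) (p : M) : TangentSpace 𝓘(ℝ, F) (ι p) :=
  normalPart E ι p (J (ι p) (ξ p))

variable (E) in
/-- The `f`-structure in the normal bundle is parallel, `Df = 0`: `D_X (f ξ) = f (D_X ξ)`. -/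
def HasParallelFStructure (ι : M → N)
    (J : Π x : N, TangentSpace 𝓘(ℝ, F) x →L[ℝ] TangentSpace 𝓘(ℝ, F) x) : Prop :=
  ∀ X : Π p : M, TangentSpace 𝓘(ℝ, E) p, IsSmoothField X →
    ∀ ξ : Π p : M, TangentSpace 𝓘(ℝ, F) (ι p), IsSmoothNormalField E ι ξ →
      ∀ p : M, normalCov ι X (fStructure E ι J ξ) p = fStructure E ι J (normalCov ι X ξ) p

end Submanifold

end TotallyReal

end

/-! `J` maps the tangent bundle of `M` isometrically into its normal bundle, and `f (J dι Y) = 0`.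
The parallelism of `f` therefore forces the normal part of `J σ(X, Y)` to vanish. Consequently
`D_X (J dι Y) = J dι (∇_X Y)`, whence `R^⊥(X, Y)(J dι Z) = J dι (R(X, Y) Z)`; moreover `J H` is
tangent, so `H = J dι Z` for a smooth vector field `Z`. If `R^⊥ H = 0`, then `R(X, Z) Z = 0` for
all `X`. As `n > 1`, we may choose `X ≠ 0` orthogonal to `Z`, and then
`0 = g(R(X, Z) Z, X) = c |X|² |Z|²`. -/

open scoped Topology
open Filter

noncomputable section

namespace TotallyReal

lemma exists_ne_zero_inner_eq_zero {V : Type*} [NormedAddCommGroup V] [InnerProductSpace ℝ V]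
    (h : 1 < finrank ℝ V) (v : V) : ∃ w : V, w ≠ 0 ∧ inner ℝ w v = 0 := by
  have : FiniteDimensional ℝ V := .of_finrank_pos (by omega)
  obtain ⟨w, hw, hw0⟩ := Submodule.exists_mem_ne_zero_of_ne_bot
    (LinearMap.ker_ne_bot_of_finrank_lt (f := innerₛₗ ℝ v) (by simpa))
  exact ⟨w, hw0, (real_inner_comm v w).trans hw⟩

section OrthonormalFrame

variable {E : Type*} [NormedAddCommGroup E] [NormedSpace ℝ E]
  {H : Type*} [TopologicalSpace H] {I : ModelWithCorners ℝ E H} {n : ℕ∞ω}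
  {B : Type*} [TopologicalSpace B] [ChartedSpace H B]
  {F : Type*} [NormedAddCommGroup F] [NormedSpace ℝ F]
  {V : B → Type*} [TopologicalSpace (TotalSpace F V)] [∀ x, NormedAddCommGroup (V x)]
  [∀ x, InnerProductSpace ℝ (V x)] [FiberBundle F V] [VectorBundle ℝ F V]
  [IsContMDiffRiemannianBundle I n F V]

section GramSchmidt

variable {ι : Type*} [LinearOrder ι] [LocallyFiniteOrderBot ι] [WellFoundedLT ι]
  {s : ι → Π x : B, V x} {p : B}

lemma contMDiffAt_gramSchmidt (hs : ∀ i, CMDiffAt n (T% (s i)) p)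
    (hli : LinearIndependent ℝ (fun i ↦ s i p)) (i : ι) :
    CMDiffAt n (T% (fun x ↦ InnerProductSpace.gramSchmidt ℝ (fun i ↦ s i x) i)) p := by
  induction i using WellFoundedLT.induction with
  | ind i ih =>
    set g : ι → Π x : B, V x :=
      fun j x ↦ InnerProductSpace.gramSchmidt ℝ (fun i ↦ s i x) j with hg
    have hgi : g i = s i - fun x ↦ ∑ j ∈ Finset.Iio i,
        ((fun x ↦ inner ℝ (g j x) (s i x) / inner ℝ (g j x) (g j x) : B → ℝ) • g j) x := by
      funext x
      simpa [hg, eq_sub_iff_add_eq] using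
        (InnerProductSpace.gramSchmidt_def'' ℝ (fun i ↦ s i x) i).symm
    change CMDiffAt n (T% (g i)) p
    rw [hgi]
    refine (hs i).sub_section (ContMDiffAt.sum_section fun j hj ↦ ?_)
    have hgj := ih j (Finset.mem_Iio.1 hj)
    have hgj0 := InnerProductSpace.gramSchmidt_ne_zero j hli
    exact ((hgj.inner_bundle (hs i)).div₀ (hgj.inner_bundle hgj)
      (inner_self_ne_zero.2 hgj0)).smul_section hgj

lemma contMDiffAt_gramSchmidtNormed (hs : ∀ i, CMDiffAt n (T% (s i)) p)
    (hli : LinearIndependent ℝ (fun i ↦ s i p)) (i : ι) :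
    CMDiffAt n (T% (fun x ↦ InnerProductSpace.gramSchmidtNormed ℝ (fun i ↦ s i x) i)) p := by
  have hg := contMDiffAt_gramSchmidt hs hli i
  have hg0 := InnerProductSpace.gramSchmidt_ne_zero i hli
  set g : Π x : B, V x := fun x ↦ InnerProductSpace.gramSchmidt ℝ (fun i ↦ s i x) i
  set g' : Π x : B, V x := fun x ↦ InnerProductSpace.gramSchmidtNormed ℝ (fun i ↦ s i x) i
  have hnormed : g' = ((fun x ↦ (Real.sqrt (inner ℝ (g x) (g x)))⁻¹) : B → ℝ) • g := by
    funext x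
    simp [InnerProductSpace.gramSchmidtNormed, g, g']
  change CMDiffAt n (T% g') p
  rw [hnormed]
  refine ContMDiffAt.smul_section (ContMDiffAt.inv₀ ?_ ?_) hg
  · exact (Real.contDiffAt_sqrt (inner_self_ne_zero.2 hg0)).contMDiffAt.comp p (hg.inner_bundle hg)
  · exact (Real.sqrt_pos.2 (real_inner_self_pos.2 hg0)).ne'

end GramSchmidt

variable [FiniteDimensional ℝ F] [ContMDiffVectorBundle n F V I]

variable (I n F V) in
lemma exists_contMDiffAt_orthonormalBasis (p : B) :
    ∃ s : Fin (finrank ℝ F) → Π x : B, V x, ∀ᶠ q in 𝓝 p, (∀ i, CMDiffAt n (T% (s i)) q) ∧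
      ∃ b : OrthonormalBasis (Fin (finrank ℝ F)) ℝ (V q), ∀ i, b i = s i q := by
  let e := trivializationAt F V p
  let u := e.localFrame (finBasis ℝ F)
  refine ⟨fun i x ↦ InnerProductSpace.gramSchmidtNormed ℝ (fun i ↦ u i x) i, ?_⟩
  filter_upwards [e.open_baseSet.mem_nhds (FiberBundle.mem_baseSet_trivializationAt' p)] with q hq
  have hu := fun i ↦ contMDiffAt_localFrame_of_mem (I := I) (n := n) e (finBasis ℝ F) i hq
  have hbasis : (fun i ↦ u i q) = e.basisAt (finBasis ℝ F) hq :=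
    funext fun i ↦ e.localFrame_apply_of_mem_baseSet _ hq
  have hli : LinearIndependent ℝ (fun i ↦ u i q) := hbasis ▸ Basis.linearIndependent _
  have hspan : Submodule.span ℝ (Set.range fun i ↦ u i q) = ⊤ := hbasis ▸ Basis.span_eq _
  refine ⟨contMDiffAt_gramSchmidtNormed hu hli, ?_⟩
  rw [← InnerProductSpace.span_gramSchmidt,
    ← InnerProductSpace.span_gramSchmidtNormed_range] at hspan
  exact ⟨.mk (InnerProductSpace.gramSchmidtNormed_orthonormal hli) hspan.ge, fun i ↦ by simp⟩

lemma contMDiffAt_section_of_inner {W : Π x : B, V x} {p : B}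
    (h : ∀ s : Π x : B, V x, CMDiffAt n (T% s) p → CMDiffAt n (fun q ↦ inner ℝ (s q) (W q)) p) :
    CMDiffAt n (T% W) p := by
  obtain ⟨s, hs⟩ := exists_contMDiffAt_orthonormalBasis I n F V p
  have hsp := hs.self_of_nhds.1
  have hsum : CMDiffAt n
      (T% (fun x ↦ ∑ i, (((fun q ↦ inner ℝ (s i q) (W q)) : B → ℝ) • s i) x)) p :=
    ContMDiffAt.sum_section fun i _ ↦ (h _ (hsp i)).smul_section (hsp i)
  refine hsum.congr_of_eventuallyEq ?_
  filter_upwards [hs] with q ⟨_, b, hb⟩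
  rw [← b.sum_repr' (W q)]
  simp [hb]

end OrthonormalFrame

section ChainRule

variable {E : Type*} [NormedAddCommGroup E] [NormedSpace ℝ E]
  {H : Type*} [TopologicalSpace H] {I : ModelWithCorners ℝ E H}
  {M : Type*} [TopologicalSpace M] [ChartedSpace H M]
  {E' : Type*} [NormedAddCommGroup E'] [NormedSpace ℝ E']
  {H' : Type*} [TopologicalSpace H'] {I' : ModelWithCorners ℝ E' H'}
  {M' : Type*} [TopologicalSpace M'] [ChartedSpace H' M']
  {G : Type*} [NormedAddCommGroup G] [NormedSpace ℝ G]
  {p : M}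

lemma mvfderiv_comp_vector_apply {g : M' → G} {f : M → M'} (hg : MDiffAt g (f p))
    (hf : MDiffAt f p) (v : TangentSpace I p) :
    mvfderiv I (g ∘ f) p v = mvfderiv I' g (f p) (mfderiv I I' f p v) :=
  mfderiv_comp_apply p hg hf v

lemma mvfderiv_congr {f g : M → G} (h : f =ᶠ[𝓝 p] g) : mvfderiv I f p = mvfderiv I g p := by
  ext v
  simp only [mvfderiv, h.mfderiv_eq]
  rfl

lemma mvfderiv_eq_fderiv {g : E → G} {x v : E} : mvfderiv 𝓘(ℝ, E) g x v = fderiv ℝ g x v :=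
  DFunLike.congr_fun mfderiv_eq_fderiv v

end ChainRule

section DirectionalDerivative

variable {E : Type*} [NormedAddCommGroup E] [NormedSpace ℝ E]
  {M : Type*} [TopologicalSpace M] [ChartedSpace E M]
  {E' : Type*} [NormedAddCommGroup E'] [NormedSpace ℝ E']
  {M' : Type*} [TopologicalSpace M'] [ChartedSpace E' M']
  {G : Type*} [NormedAddCommGroup G] [NormedSpace ℝ G]
  {p : M}

variable [IsManifold 𝓘(ℝ, E) ∞ M] {X : Π x : M, TangentSpace 𝓘(ℝ, E) x}

lemma contMDiffAt_mfderiv_apply [IsManifold 𝓘(ℝ, E') ∞ M'] {f : M → M'}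
    (hf : CMDiffAt ∞ f p) (hX : CMDiffAt ∞ (T% X) p) :
    CMDiffAt ∞ (fun q ↦ (⟨f q, mfderiv% f q (X q)⟩ : TangentBundle 𝓘(ℝ, E') M')) p :=
  (hf.mfderiv_const (m := ∞) (by simp)).clm_apply_of_inCoordinates
    (E₁ := fun x : M ↦ TangentSpace 𝓘(ℝ, E) x)
    (E₂ := fun x : M' ↦ TangentSpace 𝓘(ℝ, E') x) (b₁ := id) hX hf

lemma contMDiffAt_mvfderiv_apply {f : M → G} (hf : CMDiffAt ∞ f p) (hX : CMDiffAt ∞ (T% X) p) :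
    CMDiffAt ∞ (fun q ↦ mvfderiv 𝓘(ℝ, E) f q (X q)) p := by
  simpa using! (contMDiffAt_totalSpace.1 (contMDiffAt_mfderiv_apply hf hX)).2

end DirectionalDerivative

section Commutator

variable {E : Type*} [NormedAddCommGroup E] [NormedSpace ℝ E]
  {M : Type*} [TopologicalSpace M] [ChartedSpace E M]
  {G : Type*} [NormedAddCommGroup G] [NormedSpace ℝ G] {h : M → G} {p : M}
  {V X Y : Π x : M, TangentSpace 𝓘(ℝ, E) x}

/-- The vector field `V` read in the preferred chart at `p`: a vector field on the model space,
used to reduce statements on derivatives along vector fields to the model space. -/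
def chartField (p : M) (V : Π x : M, TangentSpace 𝓘(ℝ, E) x) : E → E :=
  mpullback 𝓘(ℝ, E) 𝓘(ℝ, E) (extChartAt 𝓘(ℝ, E) p).symm V

section

variable [IsManifold 𝓘(ℝ, E) 1 M]

lemma mvfderiv_extChartAt_self (v : TangentSpace 𝓘(ℝ, E) p) :
    mvfderiv 𝓘(ℝ, E) (extChartAt 𝓘(ℝ, E) p) p v = v := by
  rw [mvfderiv, mfderiv_extChartAt_self]
  rfl

lemma mlieBracket_eq_lieBracket_chartField :
    mlieBracket 𝓘(ℝ, E) X Y p =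
      lieBracket ℝ (chartField p X) (chartField p Y) (extChartAt 𝓘(ℝ, E) p p) := by
  have hcoord : mlieBracket 𝓘(ℝ, E) X Y p =
      lieBracketWithin ℝ (chartField p X) (chartField p Y) Set.univ (extChartAt 𝓘(ℝ, E) p p) := by
    rw [mlieBracket, mlieBracketWithin_apply, mfderiv_extChartAt_self]
    simp only [chartField, modelWithCornersSelf_coe, Set.range_id, mpullbackWithin_univ,
      Set.preimage_univ, Set.inter_univ]
    exact congrArg (fun L : E →L[ℝ] E ↦ L _) ContinuousLinearMap.inverse_id
  rw [hcoord, lieBracketWithin_univ]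

lemma chartField_extChartAt {q : M} (hq : q ∈ (extChartAt 𝓘(ℝ, E) p).source) :
    chartField p V (extChartAt 𝓘(ℝ, E) p q) =
      mvfderiv 𝓘(ℝ, E) (extChartAt 𝓘(ℝ, E) p) q (V q) := by
  set ψ := extChartAt 𝓘(ℝ, E) p
  have hinv := ContinuousLinearMap.inverse_eq
    (mfderivWithin_extChartAt_symm_comp_mfderiv_extChartAt (I := 𝓘(ℝ, E)) (ψ.map_source hq))
    (mfderiv_extChartAt_comp_mfderivWithin_extChartAt_symm (I := 𝓘(ℝ, E)) (ψ.map_source hq))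
  simp only [modelWithCornersSelf_coe, Set.range_id, mfderivWithin_univ] at hinv
  rw [chartField, mpullback_apply, hinv, ψ.left_inv hq]
  rfl

lemma chartField_extChartAt_self : chartField p V (extChartAt 𝓘(ℝ, E) p p) = V p :=
  (chartField_extChartAt (mem_extChartAt_source p)).trans (mvfderiv_extChartAt_self _)

lemma mvfderiv_apply_eventuallyEq (hh : CMDiffAt 1 h p) :
    (fun q ↦ mvfderiv 𝓘(ℝ, E) h q (V q)) =ᶠ[𝓝 p]
      (fun z ↦ fderiv ℝ (h ∘ (extChartAt 𝓘(ℝ, E) p).symm) z (chartField p V z)) ∘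
        extChartAt 𝓘(ℝ, E) p := by
  set ψ := extChartAt 𝓘(ℝ, E) p
  have hdiff : ∀ᶠ q in 𝓝 p, DifferentiableAt ℝ (h ∘ ψ.symm) (ψ q) := by
    have hcont : ContDiffAt ℝ 1 (h ∘ ψ.symm) (ψ p) := by
      simpa [contDiffWithinAt_univ] using! (contMDiffAt_iff.1 hh).2
    exact (continuousAt_extChartAt p).eventually ((hcont.eventually (by simp)).mono
      fun _ hz ↦ hz.differentiableAt (by simp))
  have hsource := extChartAt_source_mem_nhds (I := 𝓘(ℝ, E)) p
  filter_upwards [hdiff, hsource, eventually_eventually_nhds.2 hsource] with q hq hqs hqn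
  have hchart : h =ᶠ[𝓝 q] (h ∘ ψ.symm) ∘ ψ := hqn.mono fun y hy ↦ by simp [ψ.left_inv hy]
  rw [mvfderiv_congr hchart, mvfderiv_comp_vector_apply hq.mdifferentiableAt
    (mdifferentiableAt_extChartAt (by simpa [ψ] using hqs)), Function.comp_apply,
    chartField_extChartAt hqs]
  exact mvfderiv_eq_fderiv

end

variable [IsManifold 𝓘(ℝ, E) 2 M] [CompleteSpace E]

lemma differentiableAt_chartField (hV : MDiffAt (T% V) p) :
    DifferentiableAt ℝ (chartField p V) (extChartAt 𝓘(ℝ, E) p p) := by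
  have h := (mdifferentiableWithinAt_univ.2 hV).differentiableWithinAt_mpullbackWithin_vectorField
  simp only [modelWithCornersSelf_coe, Set.range_id, mpullbackWithin_univ, Set.preimage_univ,
    Set.inter_univ] at h
  exact differentiableWithinAt_univ.1 h

theorem mvfderiv_apply_mlieBracket (hh : CMDiffAt 2 h p) (hX : MDiffAt (T% X) p)
    (hY : MDiffAt (T% Y) p) :
    mvfderiv 𝓘(ℝ, E) h p (mlieBracket 𝓘(ℝ, E) X Y p) =
      mvfderiv 𝓘(ℝ, E) (fun q ↦ mvfderiv 𝓘(ℝ, E) h q (Y q)) p (X p) -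
        mvfderiv 𝓘(ℝ, E) (fun q ↦ mvfderiv 𝓘(ℝ, E) h q (X q)) p (Y p) := by
  set ψ := extChartAt 𝓘(ℝ, E) p
  have hh' : ContDiffAt ℝ 2 (h ∘ ψ.symm) (ψ p) := by
    simpa [contDiffWithinAt_univ] using! (contMDiffAt_iff.1 hh).2
  have hcoord {V : Π x : M, TangentSpace 𝓘(ℝ, E) x} := mvfderiv_apply_eventuallyEq (V := V)
    (hh.of_le one_le_two)
  have hderiv {V : Π x : M, TangentSpace 𝓘(ℝ, E) x} (hV : MDiffAt (T% V) p)
      (v : TangentSpace 𝓘(ℝ, E) p) :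
      mvfderiv 𝓘(ℝ, E) (fun q ↦ mvfderiv 𝓘(ℝ, E) h q (V q)) p v =
        fderiv ℝ (fun z ↦ fderiv ℝ (h ∘ ψ.symm) z (chartField p V z)) (ψ p) v := by
    rw [mvfderiv_congr hcoord, mvfderiv_comp_vector_apply
      (((hh'.fderiv_right (m := 1) one_add_one_eq_two.le).differentiableAt (by simp)).clm_apply
        (differentiableAt_chartField hV)).mdifferentiableAt
      (mdifferentiableAt_extChartAt (mem_chart_source E p)), mfderiv_extChartAt_self]
    exact mvfderiv_eq_fderiv
  have hbracket : mvfderiv 𝓘(ℝ, E) h p (mlieBracket 𝓘(ℝ, E) X Y p) =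
      fderiv ℝ (h ∘ ψ.symm) (ψ p) (lieBracket ℝ (chartField p X) (chartField p Y) (ψ p)) := by
    rw [← mlieBracket_eq_lieBracket_chartField]
    exact hcoord.self_of_nhds.trans (congrArg _ chartField_extChartAt_self)
  rw [hbracket, fderiv_apply_lieBracket hh' (by simp)
    (differentiableAt_chartField hY) (differentiableAt_chartField hX), hderiv hX, hderiv hY,
    chartField_extChartAt_self, chartField_extChartAt_self]

end Commutator

section LeviCivita

variable {E : Type*} [NormedAddCommGroup E] [NormedSpace ℝ E]
  {M : Type*} [TopologicalSpace M] [ChartedSpace E M] [IsManifold 𝓘(ℝ, E) ∞ M]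
  {X Y Z : Π x : M, TangentSpace 𝓘(ℝ, E) x} {p : M}

lemma eventually_mdifferentiableAt (hX : CMDiffAt ∞ (T% X) p) : ∀ᶠ q in 𝓝 p, MDiffAt (T% X) q :=
  ((contMDiffAt_iff_contMDiffAt_nhds (by simp)).1 (hX.of_le (m := 1) (by simp))).mono
    fun _ h ↦ h.mdifferentiableAt (by simp)

lemma contMDiffAt_mlieBracket [CompleteSpace E] (hX : CMDiffAt ∞ (T% X) p)
    (hY : CMDiffAt ∞ (T% Y) p) : CMDiffAt ∞ (T% (mlieBracket 𝓘(ℝ, E) X Y)) p := by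
  have : IsManifold 𝓘(ℝ, E) ((∞ : ℕ∞ω) + 1) M := by simpa
  have : IsManifold 𝓘(ℝ, E) (minSmoothness ℝ 2) M := by
    rw [minSmoothness_of_isRCLikeNormedField]
    infer_instance
  exact ContMDiffAt.mlieBracket_vectorField hX hY (by simp)

lemma exists_isSmoothField_eventuallyEq_extend [FiniteDimensional ℝ E] [T2Space M]
    (v : TangentSpace 𝓘(ℝ, E) p) : ∃ X : Π x : M, TangentSpace 𝓘(ℝ, E) x, IsSmoothField X ∧
      ∀ᶠ q in 𝓝 p, X q = FiberBundle.extend E v q := by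
  obtain ⟨u, hu, hs⟩ := FiberBundle.exists_contMDiffOn_extend (k := ∞) 𝓘(ℝ, E) E v
  obtain ⟨ψ, hψ, -⟩ := (SmoothBumpFunction.nhds_basis_support (I := 𝓘(ℝ, E))
    (interior_mem_nhds.2 hu)).mem_iff.1 (interior_mem_nhds.2 hu)
  refine ⟨(ψ : M → ℝ) • FiberBundle.extend E v, ContMDiffOn.smul_section_of_tsupport
    ψ.contMDiff.contMDiffOn isOpen_interior hψ (hs.mono interior_subset), ?_⟩
  filter_upwards [ψ.eventuallyEq_one] with q hq
  simp [hq]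

variable [RiemannianBundle (fun x : M ↦ TangentSpace 𝓘(ℝ, E) x)]
  [IsContMDiffRiemannianBundle 𝓘(ℝ, E) ∞ E (fun x : M ↦ TangentSpace 𝓘(ℝ, E) x)]

lemma contMDiffAt_inner {E' : Type*} [NormedAddCommGroup E'] [NormedSpace ℝ E']
    {M' : Type*} [TopologicalSpace M'] [ChartedSpace E' M'] {f : M' → M}
    {V W : Π q : M', TangentSpace 𝓘(ℝ, E) (f q)} {p : M'}
    (hV : CMDiffAt ∞ (fun q ↦ (⟨f q, V q⟩ : TangentBundle 𝓘(ℝ, E) M)) p)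
    (hW : CMDiffAt ∞ (fun q ↦ (⟨f q, W q⟩ : TangentBundle 𝓘(ℝ, E) M)) p) :
    CMDiffAt ∞ (fun q ↦ inner ℝ (V q) (W q)) p :=
  ContMDiffAt.inner_bundle (E := fun x : M ↦ TangentSpace 𝓘(ℝ, E) x) hV hW

variable [CompleteSpace E]

lemma contMDiffAt_koszul (hX : CMDiffAt ∞ (T% X) p) (hY : CMDiffAt ∞ (T% Y) p)
    (hZ : CMDiffAt ∞ (T% Z) p) : CMDiffAt ∞ (koszul Y X Z) p := by
  have hYZ := contMDiffAt_mvfderiv_apply (contMDiffAt_inner (f := id) hY hZ) hX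
  have hZX := contMDiffAt_mvfderiv_apply (contMDiffAt_inner (f := id) hZ hX) hY
  have hXY := contMDiffAt_mvfderiv_apply (contMDiffAt_inner (f := id) hX hY) hZ
  have hYXZ := contMDiffAt_inner (f := id) hY (contMDiffAt_mlieBracket hX hZ)
  have hZYX := contMDiffAt_inner (f := id) hZ (contMDiffAt_mlieBracket hY hX)
  have hXZY := contMDiffAt_inner (f := id) hX (contMDiffAt_mlieBracket hZ hY)
  exact ((((hYZ.add hZX).sub hXY).sub hYXZ).sub hZYX).add hXZY

variable [FiniteDimensional ℝ E]

theorem contMDiffAt_leviCivita (hX : CMDiffAt ∞ (T% X) p) (hY : CMDiffAt ∞ (T% Y) p) :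
    CMDiffAt ∞ (T% (fun q ↦ leviCivita E M Y q (X q))) p := by
  refine contMDiffAt_section_of_inner (V := fun x : M ↦ TangentSpace 𝓘(ℝ, E) x) fun Z hZ ↦ ?_
  refine ((contMDiffAt_const (c := (1 / 2 : ℝ))).mul
    (contMDiffAt_koszul hX hY hZ)).congr_of_eventuallyEq ?_
  filter_upwards [eventually_mdifferentiableAt hX, eventually_mdifferentiableAt hY,
    eventually_mdifferentiableAt hZ] with q hXq hYq hZq
  rw [real_inner_comm]
  exact inner_leviCivitaFun hXq hYq hZq

end LeviCivita

section ConnectionForm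

variable {E : Type*} [NormedAddCommGroup E] [NormedSpace ℝ E]
  {H : Type*} [TopologicalSpace H] {I : ModelWithCorners ℝ E H}
  {M : Type*} [TopologicalSpace M] [ChartedSpace H M]
  {F : Type*} [NormedAddCommGroup F] [NormedSpace ℝ F]
  {V : M → Type*} [TopologicalSpace (TotalSpace F V)] [∀ x, AddCommGroup (V x)]
  [∀ x, Module ℝ (V x)] [∀ x, TopologicalSpace (V x)] [FiberBundle F V] [VectorBundle ℝ F V]

/-- The flat connection of a local trivialization `t`: it differentiates the principal part of a
section, and is a covariant derivative over the base set of `t`. -/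
def flatConnection (t : Trivialization F (TotalSpace.proj : TotalSpace F V → M))
    [MemTrivializationAtlas t] (σ : Π x : M, V x) (x : M) : TangentSpace I x →L[ℝ] V x :=
  t.symmL ℝ x ∘L mvfderiv I (fun y ↦ (t ⟨y, σ y⟩).2) x

lemma flatConnection_extend {x : M} (v : V x) :
    flatConnection (I := I) (trivializationAt F V x) (FiberBundle.extend F v) x = 0 := by
  set t := trivializationAt F V x
  have hconst : (fun y ↦ (t ⟨y, FiberBundle.extend F v y⟩).2) =ᶠ[𝓝 x] fun _ ↦ (t ⟨x, v⟩).2 := by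
    filter_upwards [t.open_baseSet.mem_nhds (FiberBundle.mem_baseSet_trivializationAt' x)]
      with y hy
    have hsymm := congrArg Prod.snd (t.apply_mk_symm hy (t ⟨x, v⟩).2)
    exact hsymm
  rw [flatConnection, mvfderiv_congr hconst, mvfderiv_const, ContinuousLinearMap.comp_zero]

variable [∀ x, IsTopologicalAddGroup (V x)] [∀ x, ContinuousSMul ℝ (V x)]
  [ContMDiffVectorBundle 1 F V I]

lemma isCovariantDerivativeOn_flatConnection
    (t : Trivialization F (TotalSpace.proj : TotalSpace F V → M)) [MemTrivializationAtlas t] :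
    IsCovariantDerivativeOn (I := I) F (flatConnection t) t.baseSet where
  add {σ σ' x} hσ hσ' hx := by
    have hadd : (fun y ↦ (t ⟨y, (σ + σ') y⟩).2) =ᶠ[𝓝 x]
        (fun y ↦ (t ⟨y, σ y⟩).2) + fun y ↦ (t ⟨y, σ' y⟩).2 := by
      filter_upwards [t.open_baseSet.mem_nhds hx] with y hy using (t.linear ℝ hy).map_add _ _
    rw [t.mdifferentiableAt_section_iff I _ hx] at hσ hσ'
    rw [flatConnection, mvfderiv_congr hadd, mvfderiv_add hσ hσ', ContinuousLinearMap.comp_add]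
    rfl
  leibniz {σ g x} hσ hg hx := by
    have hsmul : (fun y ↦ (t ⟨y, (g • σ) y⟩).2) =ᶠ[𝓝 x] g • fun y ↦ (t ⟨y, σ y⟩).2 := by
      filter_upwards [t.open_baseSet.mem_nhds hx] with y hy using (t.linear ℝ hy).map_smul _ _
    rw [t.mdifferentiableAt_section_iff I _ hx] at hσ
    rw [flatConnection, mvfderiv_congr hsmul, mvfderiv_smul hg hσ]
    ext v
    simp [flatConnection, hx]

variable [FiniteDimensional ℝ F]

/-- The connection form of a covariant derivative at `x`, in the preferred trivialization at `x`
(the Christoffel symbols, in the case of the Levi-Civita connection): `connectionForm cov x v w` is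
the derivative in direction `w` of the section with constant principal part and value `v`. -/
def connectionForm (cov : CovariantDerivative I F V) (x : M) :
    V x →L[ℝ] TangentSpace I x →L[ℝ] V x :=
  (cov.isCovariantDerivativeOn (s := (trivializationAt F V x).baseSet)).difference
    (isCovariantDerivativeOn_flatConnection (trivializationAt F V x)) x

lemma covariantDerivative_eq_flatConnection_add (cov : CovariantDerivative I F V)
    {σ : Π x : M, V x} {x : M} (hσ : MDiffAt (T% σ) x) :
    cov σ x = flatConnection (trivializationAt F V x) σ x + connectionForm cov x (σ x) := by
  rw [connectionForm, IsCovariantDerivativeOn.difference_apply _ _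
    (FiberBundle.mem_baseSet_trivializationAt' x) hσ, add_sub_cancel]

lemma connectionForm_apply (cov : CovariantDerivative I F V) {x : M} (v : V x) :
    connectionForm cov x v = cov (FiberBundle.extend F v) x := by
  rw [covariantDerivative_eq_flatConnection_add cov (FiberBundle.mdifferentiableAt_extend I F v),
    flatConnection_extend, zero_add, FiberBundle.extend_apply_self]

end ConnectionForm

section FieldsAlong

variable {E : Type*} [NormedAddCommGroup E] [NormedSpace ℝ E] {M : Type*}
  {F : Type*} [NormedAddCommGroup F] [NormedSpace ℝ F]
  {N : Type*} [TopologicalSpace N] [ChartedSpace F N] [IsManifold 𝓘(ℝ, F) ∞ N]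

/-- The principal part at `q` of a field along `ι`, in the preferred trivialization of `TN` at
`ι p`; it is meaningful only for `q` close to `p`. -/
def principalPart (ι : M → N) (V : Π p : M, TangentSpace 𝓘(ℝ, F) (ι p)) (p q : M) : F :=
  (trivializationAt F (fun x : N ↦ TangentSpace 𝓘(ℝ, F) x) (ι p) ⟨ι q, V q⟩).2

lemma symmL_principalPart (ι : M → N) (V : Π p : M, TangentSpace 𝓘(ℝ, F) (ι p)) (p : M) :
    (trivializationAt F (fun x : N ↦ TangentSpace 𝓘(ℝ, F) x) (ι p)).symmL ℝ (ι p)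
      (principalPart ι V p p) = V p := by
  have hp := FiberBundle.mem_baseSet_trivializationAt' (F := F)
    (E := fun x : N ↦ TangentSpace 𝓘(ℝ, F) x) (ι p)
  rw [Trivialization.symmL_apply _ hp]
  exact Trivialization.symm_apply_apply_mk _ hp (V p)

variable [TopologicalSpace M] [ChartedSpace E M]

variable (E) in
/-- The field `V` along `ι : M → N` (a section of `ι^* TN`) is smooth at `p`. -/
def SmoothAlongAt (ι : M → N) (V : Π p : M, TangentSpace 𝓘(ℝ, F) (ι p)) (p : M) : Prop :=
  ContMDiffAt 𝓘(ℝ, E) 𝓘(ℝ, F).tangent ∞ (fun q ↦ (⟨ι q, V q⟩ : TangentBundle 𝓘(ℝ, F) N)) p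

variable (E) in
/-- The field `V` along `ι : M → N` is differentiable at `p`. -/
def DiffAlongAt (ι : M → N) (V : Π p : M, TangentSpace 𝓘(ℝ, F) (ι p)) (p : M) : Prop :=
  MDifferentiableAt 𝓘(ℝ, E) 𝓘(ℝ, F).tangent (fun q ↦ (⟨ι q, V q⟩ : TangentBundle 𝓘(ℝ, F) N)) p

variable {ι : M → N} {V W : Π p : M, TangentSpace 𝓘(ℝ, F) (ι p)} {p : M}

lemma smoothAlongAt_iff :
    SmoothAlongAt E ι V p ↔ CMDiffAt ∞ ι p ∧ CMDiffAt ∞ (principalPart ι V p) p :=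
  contMDiffAt_totalSpace

lemma diffAlongAt_iff :
    DiffAlongAt E ι V p ↔ MDiffAt ι p ∧ MDiffAt (principalPart ι V p) p :=
  mdifferentiableAt_totalSpace _ _

lemma SmoothAlongAt.contMDiffAt (h : SmoothAlongAt E ι V p) : CMDiffAt ∞ ι p :=
  (smoothAlongAt_iff.1 h).1

lemma SmoothAlongAt.diffAlongAt (h : SmoothAlongAt E ι V p) : DiffAlongAt E ι V p :=
  ContMDiffAt.mdifferentiableAt h (by simp)

lemma eventually_mem_baseSet (hι : ContinuousAt ι p) : ∀ᶠ q in 𝓝 p,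
    ι q ∈ (trivializationAt F (fun x : N ↦ TangentSpace 𝓘(ℝ, F) x) (ι p)).baseSet :=
  hι.eventually ((trivializationAt F (fun x : N ↦ TangentSpace 𝓘(ℝ, F) x)
    (ι p)).open_baseSet.mem_nhds (FiberBundle.mem_baseSet_trivializationAt' (ι p)))

lemma principalPart_add_eventuallyEq (hι : ContinuousAt ι p) :
    principalPart ι (fun q ↦ V q + W q) p =ᶠ[𝓝 p]
      principalPart ι V p + principalPart ι W p :=
  (eventually_mem_baseSet hι).mono fun _ hq ↦
    ((trivializationAt F (fun x : N ↦ TangentSpace 𝓘(ℝ, F) x) (ι p)).linear ℝ hq).map_add _ _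

lemma principalPart_smul_eventuallyEq (hι : ContinuousAt ι p) (a : M → ℝ) :
    principalPart ι (fun q ↦ a q • V q) p =ᶠ[𝓝 p] a • principalPart ι V p :=
  (eventually_mem_baseSet hι).mono fun _ hq ↦
    ((trivializationAt F (fun x : N ↦ TangentSpace 𝓘(ℝ, F) x) (ι p)).linear ℝ hq).map_smul _ _

lemma SmoothAlongAt.congr (h : SmoothAlongAt E ι V p) (hVW : ∀ᶠ q in 𝓝 p, V q = W q) :
    SmoothAlongAt E ι W p :=
  ContMDiffAt.congr_of_eventuallyEq h (hVW.mono fun _ hq ↦ by simp only [hq])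

lemma SmoothAlongAt.add (hV : SmoothAlongAt E ι V p) (hW : SmoothAlongAt E ι W p) :
    SmoothAlongAt E ι (fun q ↦ V q + W q) p := by
  rw [smoothAlongAt_iff] at hV hW ⊢
  exact ⟨hV.1, (hV.2.add hW.2).congr_of_eventuallyEq
    (principalPart_add_eventuallyEq hV.1.continuousAt)⟩

lemma SmoothAlongAt.smul {a : M → ℝ} (ha : CMDiffAt ∞ a p) (hV : SmoothAlongAt E ι V p) :
    SmoothAlongAt E ι (fun q ↦ a q • V q) p := by
  rw [smoothAlongAt_iff] at hV ⊢
  exact ⟨hV.1, (ha.smul hV.2).congr_of_eventuallyEq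
    (principalPart_smul_eventuallyEq hV.1.continuousAt a)⟩

lemma SmoothAlongAt.comp {U : Π x : N, TangentSpace 𝓘(ℝ, F) x} (hι : CMDiffAt ∞ ι p)
    (hU : CMDiffAt ∞ (T% U) (ι p)) : SmoothAlongAt E ι (fun q ↦ U (ι q)) p :=
  ContMDiffAt.comp p hU hι

lemma SmoothAlongAt.inner [RiemannianBundle (fun x : N ↦ TangentSpace 𝓘(ℝ, F) x)]
    [IsContMDiffRiemannianBundle 𝓘(ℝ, F) ∞ F (fun x : N ↦ TangentSpace 𝓘(ℝ, F) x)]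
    (hV : SmoothAlongAt E ι V p) (hW : SmoothAlongAt E ι W p) :
    CMDiffAt ∞ (fun q ↦ inner ℝ (V q) (W q)) p :=
  contMDiffAt_inner hV hW

lemma SmoothAlongAt.eventually_diffAlongAt [IsManifold 𝓘(ℝ, E) ∞ M] (h : SmoothAlongAt E ι V p) :
    ∀ᶠ q in 𝓝 p, DiffAlongAt E ι V q :=
  ((contMDiffAt_iff_contMDiffAt_nhds (n := 1) (by simp)).1
    (ContMDiffAt.of_le h (by simp))).mono fun _ h ↦ h.mdifferentiableAt (by simp)

variable [FiniteDimensional ℝ F]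

lemma SmoothAlongAt.exists_eventuallyEq_sum (hV : SmoothAlongAt E ι V p) :
    ∃ (a : Fin (finrank ℝ F) → M → ℝ)
      (U : Fin (finrank ℝ F) → Π x : N, TangentSpace 𝓘(ℝ, F) x),
      (∀ j, CMDiffAt ∞ (a j) p) ∧ (∀ j, CMDiffAt ∞ (T% (U j)) (ι p)) ∧
        ∀ᶠ q in 𝓝 p, ∑ j, a j q • U j (ι q) = V q := by
  let t := trivializationAt F (fun x : N ↦ TangentSpace 𝓘(ℝ, F) x) (ι p)
  let b := finBasis ℝ F
  refine ⟨fun j q ↦ b.coord j (principalPart ι V p q), t.localFrame b, fun j ↦ ?_,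
    fun j ↦ contMDiffAt_localFrame_of_mem _ t b j (FiberBundle.mem_baseSet_trivializationAt' _),
    ?_⟩
  · exact (LinearMap.toContinuousLinearMap (b.coord j)).contDiff.contMDiff.contMDiffAt.comp p
      (smoothAlongAt_iff.1 hV).2
  · filter_upwards [eventually_mem_baseSet (F := F) (N := N) hV.contMDiffAt.continuousAt] with q hq
    simp only [t.localFrame_apply_of_mem_baseSet b hq]
    exact (t.basisAt b hq).sum_repr (V q)

theorem SmoothAlongAt.induction {P : (Π p : M, TangentSpace 𝓘(ℝ, F) (ι p)) → Prop}
    (congr : ∀ V W : Π p : M, TangentSpace 𝓘(ℝ, F) (ι p),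
      (∀ᶠ q in 𝓝 p, V q = W q) → P V → P W)
    (add : ∀ V W : Π p : M, TangentSpace 𝓘(ℝ, F) (ι p), SmoothAlongAt E ι V p →
      SmoothAlongAt E ι W p → P V → P W → P (fun q ↦ V q + W q))
    (smul : ∀ (a : M → ℝ) (V : Π p : M, TangentSpace 𝓘(ℝ, F) (ι p)), CMDiffAt ∞ a p →
      SmoothAlongAt E ι V p → P V → P (fun q ↦ a q • V q))
    (comp : ∀ U : Π x : N, TangentSpace 𝓘(ℝ, F) x, CMDiffAt ∞ (T% U) (ι p) →
      P (fun q ↦ U (ι q)))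
    (hV : SmoothAlongAt E ι V p) : P V := by
  obtain ⟨a, U, ha, hU, hsum⟩ := hV.exists_eventuallyEq_sum
  refine congr _ _ hsum (And.right (a := SmoothAlongAt E ι (fun q ↦ ∑ j, a j q • U j (ι q)) p) ?_)
  induction (Finset.univ : Finset (Fin (finrank ℝ F))) using Finset.induction_on with
  | empty =>
    have hzero : CMDiffAt ∞ (T% (0 : Π x : N, TangentSpace 𝓘(ℝ, F) x)) (ι p) :=
      (contMDiff_zeroSection ℝ (fun x : N ↦ TangentSpace 𝓘(ℝ, F) x)).contMDiffAt
    simp only [Finset.sum_empty]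
    exact ⟨SmoothAlongAt.comp hV.contMDiffAt hzero, comp 0 hzero⟩
  | insert j s hj ih =>
    simp only [Finset.sum_insert hj]
    have hUj := SmoothAlongAt.comp hV.contMDiffAt (hU j)
    have haUj := hUj.smul (ha j)
    exact ⟨haUj.add ih.1, add _ _ haUj ih.1 (smul _ _ (ha j) hUj (comp _ (hU j))) ih.2⟩

end FieldsAlong

section CovAlong

variable {E : Type*} [NormedAddCommGroup E] [NormedSpace ℝ E]
  {M : Type*} [TopologicalSpace M] [ChartedSpace E M]
  {F : Type*} [NormedAddCommGroup F] [NormedSpace ℝ F] [FiniteDimensional ℝ F] [CompleteSpace F]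
  {N : Type*} [TopologicalSpace N] [ChartedSpace F N] [IsManifold 𝓘(ℝ, F) ∞ N]
  [RiemannianBundle (fun x : N ↦ TangentSpace 𝓘(ℝ, F) x)]
  [IsContMDiffRiemannianBundle 𝓘(ℝ, F) ∞ F (fun x : N ↦ TangentSpace 𝓘(ℝ, F) x)]
  {ι : M → N} {V W : Π p : M, TangentSpace 𝓘(ℝ, F) (ι p)} {p : M}

lemma covAlong_eq (v : TangentSpace 𝓘(ℝ, E) p) :
    covAlong ι V p v =
      (trivializationAt F (fun x : N ↦ TangentSpace 𝓘(ℝ, F) x) (ι p)).symmL ℝ (ι p)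
        (mvfderiv 𝓘(ℝ, E) (principalPart ι V p) p v) +
      connectionForm (leviCivita F N) (ι p) (V p) (mfderiv% ι p v) := by
  rw [Trivialization.symmL_apply _ (FiberBundle.mem_baseSet_trivializationAt' (ι p)),
    connectionForm_apply]
  rfl

lemma covAlong_congr (hVW : ∀ᶠ q in 𝓝 p, V q = W q) (v : TangentSpace 𝓘(ℝ, E) p) :
    covAlong ι V p v = covAlong ι W p v := by
  have h : principalPart ι V p =ᶠ[𝓝 p] principalPart ι W p :=
    hVW.mono fun q hq ↦ by simp [principalPart, hq]
  rw [covAlong_eq, covAlong_eq, hVW.self_of_nhds, mvfderiv_congr h]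

lemma covAlong_add (hV : DiffAlongAt E ι V p) (hW : DiffAlongAt E ι W p)
    (v : TangentSpace 𝓘(ℝ, E) p) :
    covAlong ι (fun q ↦ V q + W q) p v = covAlong ι V p v + covAlong ι W p v := by
  rw [diffAlongAt_iff] at hV hW
  simp only [covAlong_eq, mvfderiv_congr (principalPart_add_eventuallyEq hV.1.continuousAt),
    mvfderiv_add hV.2 hW.2, add_apply, map_add]
  exact add_add_add_comm _ _ _ _

lemma covAlong_smul {a : M → ℝ} (ha : MDiffAt a p) (hV : DiffAlongAt E ι V p)
    (v : TangentSpace 𝓘(ℝ, E) p) :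
    covAlong ι (fun q ↦ a q • V q) p v =
      a p • covAlong ι V p v + mvfderiv 𝓘(ℝ, E) a p v • V p := by
  rw [diffAlongAt_iff] at hV
  simp only [covAlong_eq, mvfderiv_congr (principalPart_smul_eventuallyEq hV.1.continuousAt a),
    mvfderiv_smul ha hV.2, add_apply, smul_apply, map_add, map_smul, smul_add,
    ContinuousLinearMap.smulRight_apply, symmL_principalPart]
  exact add_right_comm _ _ _

lemma covAlong_comp {U : Π x : N, TangentSpace 𝓘(ℝ, F) x} (hι : MDiffAt ι p)
    (hU : MDiffAt (T% U) (ι p)) (v : TangentSpace 𝓘(ℝ, E) p) :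
    covAlong ι (fun q ↦ U (ι q)) p v = leviCivita F N U (ι p) (mfderiv% ι p v) := by
  have hcomp : principalPart ι (fun q ↦ U (ι q)) p =
      (fun x ↦ (trivializationAt F (fun x : N ↦ TangentSpace 𝓘(ℝ, F) x) (ι p) ⟨x, U x⟩).2) ∘ ι :=
    rfl
  have hU' := (mdifferentiableAt_totalSpace _ _).1 hU
  rw [covAlong_eq, covariantDerivative_eq_flatConnection_add _ hU, hcomp,
    mvfderiv_comp_vector_apply hU'.2 hι]
  rfl

end CovAlong

section SmoothAlong

variable {E : Type*} [NormedAddCommGroup E] [NormedSpace ℝ E]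
  {M : Type*} [TopologicalSpace M] [ChartedSpace E M]
  {F : Type*} [NormedAddCommGroup F] [NormedSpace ℝ F] [FiniteDimensional ℝ F] [CompleteSpace F]
  {N : Type*} [TopologicalSpace N] [ChartedSpace F N] [IsManifold 𝓘(ℝ, F) ∞ N]
  [RiemannianBundle (fun x : N ↦ TangentSpace 𝓘(ℝ, F) x)]
  [IsContMDiffRiemannianBundle 𝓘(ℝ, F) ∞ F (fun x : N ↦ TangentSpace 𝓘(ℝ, F) x)]
  {ι : M → N} {V W : Π p : M, TangentSpace 𝓘(ℝ, F) (ι p)} {p : M}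

lemma IsKaehler.smoothAlongAt
    {J : Π x : N, TangentSpace 𝓘(ℝ, F) x →L[ℝ] TangentSpace 𝓘(ℝ, F) x} (hJ : IsKaehler J)
    (hV : SmoothAlongAt E ι V p) : SmoothAlongAt E ι (fun q ↦ J (ι q) (V q)) p :=
  ContMDiffAt.clm_bundle_apply (E₁ := fun x : N ↦ TangentSpace 𝓘(ℝ, F) x)
    (E₂ := fun x : N ↦ TangentSpace 𝓘(ℝ, F) x) (F₁ := F) (F₂ := F)
    (hJ.smooth.contMDiffAt.comp p hV.contMDiffAt) hV

theorem IsKaehler.covAlong_apply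
    {J : Π x : N, TangentSpace 𝓘(ℝ, F) x →L[ℝ] TangentSpace 𝓘(ℝ, F) x} (hJ : IsKaehler J)
    (hV : SmoothAlongAt E ι V p) (v : TangentSpace 𝓘(ℝ, E) p) :
    covAlong ι (fun q ↦ J (ι q) (V q)) p v = J (ι p) (covAlong ι V p v) := by
  refine hV.induction (P := fun V ↦
    covAlong ι (fun q ↦ J (ι q) (V q)) p v = J (ι p) (covAlong ι V p v)) ?_ ?_ ?_ ?_
  · intro V W hVW hV
    rw [← covAlong_congr hVW, ← hV]
    exact (covAlong_congr (hVW.mono fun q hq ↦ by rw [hq]) v).symm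
  · intro V W hV hW hJV hJW
    simp only [map_add]
    rw [covAlong_add (hJ.smoothAlongAt hV).diffAlongAt (hJ.smoothAlongAt hW).diffAlongAt,
      covAlong_add hV.diffAlongAt hW.diffAlongAt, hJV, hJW, map_add]
  · intro a V ha hV hJV
    have ha' := ha.mdifferentiableAt (by simp)
    simp only [map_smul]
    rw [covAlong_smul ha' (hJ.smoothAlongAt hV).diffAlongAt, covAlong_smul ha' hV.diffAlongAt,
      hJV, map_add, map_smul, map_smul]
  · intro U hU
    have hι := hV.contMDiffAt.mdifferentiableAt (by simp)
    have hU' := hU.mdifferentiableAt (by simp)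
    have hJU : MDiffAt (T% (fun x ↦ J x (U x))) (ι p) :=
      (hJ.smoothAlongAt (ι := (id : N → N)) (V := U) hU).diffAlongAt
    rw [covAlong_comp (U := fun x ↦ J x (U x)) hι hJU, covAlong_comp hι hU',
      hJ.parallel U _ hU']

lemma mvfderiv_inner_along_of_comp (hV : SmoothAlongAt E ι V p) (hW : SmoothAlongAt E ι W p)
    (v : TangentSpace 𝓘(ℝ, E) p)
    (hcomp : ∀ U : Π x : N, TangentSpace 𝓘(ℝ, F) x, CMDiffAt ∞ (T% U) (ι p) →
      mvfderiv 𝓘(ℝ, E) (fun q ↦ inner ℝ (U (ι q)) (W q)) p v =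
        inner ℝ (covAlong ι (fun q ↦ U (ι q)) p v) (W p) +
          inner ℝ (U (ι p)) (covAlong ι W p v)) :
    mvfderiv 𝓘(ℝ, E) (fun q ↦ inner ℝ (V q) (W q)) p v =
      inner ℝ (covAlong ι V p v) (W p) + inner ℝ (V p) (covAlong ι W p v) := by
  have hd {V} (hV : SmoothAlongAt E ι V p) : MDiffAt (fun q ↦ inner ℝ (V q) (W q)) p :=
    (hV.inner hW).mdifferentiableAt (by simp)
  refine hV.induction (P := fun V ↦ mvfderiv 𝓘(ℝ, E) (fun q ↦ inner ℝ (V q) (W q)) p v =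
    inner ℝ (covAlong ι V p v) (W p) + inner ℝ (V p) (covAlong ι W p v)) ?_ ?_ ?_ hcomp
  · intro V V' hVV' hV
    have h : (fun q ↦ inner ℝ (V q) (W q)) =ᶠ[𝓝 p] fun q ↦ inner ℝ (V' q) (W q) :=
      hVV'.mono fun q hq ↦ by simp only [hq]
    rw [← covAlong_congr hVV', ← hVV'.self_of_nhds, ← hV, mvfderiv_congr h]
  · intro V V' hV hV' hVW hV'W
    simp only [inner_add_left]
    rw [mvfderiv_fun_add (hd hV) (hd hV'), covAlong_add hV.diffAlongAt hV'.diffAlongAt,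
      inner_add_left, add_apply, hVW, hV'W]
    ring
  · intro a V ha hV hVW
    have ha' := ha.mdifferentiableAt (by simp)
    simp only [real_inner_smul_left]
    rw [mvfderiv_fun_mul ha' (hd hV), covAlong_smul ha' hV.diffAlongAt, inner_add_left,
      real_inner_smul_left, real_inner_smul_left, add_apply, smul_apply, smul_apply, hVW,
      smul_eq_mul, smul_eq_mul]
    ring

theorem mvfderiv_inner_along (hV : SmoothAlongAt E ι V p) (hW : SmoothAlongAt E ι W p)
    (v : TangentSpace 𝓘(ℝ, E) p) :
    mvfderiv 𝓘(ℝ, E) (fun q ↦ inner ℝ (V q) (W q)) p v =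
      inner ℝ (covAlong ι V p v) (W p) + inner ℝ (V p) (covAlong ι W p v) := by
  refine mvfderiv_inner_along_of_comp hV hW v fun U hU ↦ ?_
  simp only [real_inner_comm (W _), fun y ↦ real_inner_comm y (U (ι p))]
  rw [add_comm]
  refine mvfderiv_inner_along_of_comp hW (.comp hV.contMDiffAt hU) v fun U' hU' ↦ ?_
  have hι := hV.contMDiffAt.mdifferentiableAt (by simp)
  have hUd := hU.mdifferentiableAt (by simp)
  have hUd' := hU'.mdifferentiableAt (by simp)
  rw [covAlong_comp hι hUd, covAlong_comp hι hUd', ← leviCivita_metric hUd' hUd]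
  exact mvfderiv_comp_vector_apply (mdiffAt_metric hUd' hUd) hι v

lemma SmoothAlongAt.leviCivita_comp {U : Π x : N, TangentSpace 𝓘(ℝ, F) x}
    (hU : CMDiffAt ∞ (T% U) (ι p)) (hV : SmoothAlongAt E ι V p) :
    SmoothAlongAt E ι (fun q ↦ leviCivita F N U (ι q) (V q)) p := by
  refine hV.induction (P := fun V ↦
    SmoothAlongAt E ι (fun q ↦ leviCivita F N U (ι q) (V q)) p) ?_ ?_ ?_ ?_
  · exact fun V W hVW hV ↦ hV.congr (hVW.mono fun q hq ↦ by rw [hq])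
  · intro V W _ _ hV hW
    simpa only [map_add] using hV.add hW
  · intro a V ha _ hV
    simpa only [map_smul] using hV.smul ha
  · exact fun U' hU' ↦ .comp hV.contMDiffAt (contMDiffAt_leviCivita hU' hU)

variable [IsManifold 𝓘(ℝ, E) ∞ M]

theorem SmoothAlongAt.covAlong {X : Π x : M, TangentSpace 𝓘(ℝ, E) x}
    (hV : SmoothAlongAt E ι V p) (hX : CMDiffAt ∞ (T% X) p) :
    SmoothAlongAt E ι (fun q ↦ covAlong ι V q (X q)) p := by
  refine hV.induction (P := fun V ↦
    SmoothAlongAt E ι (fun q ↦ TotallyReal.covAlong ι V q (X q)) p) ?_ ?_ ?_ ?_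
  · exact fun V W hVW hV ↦ hV.congr (hVW.eventually_nhds.mono fun q hq ↦ covAlong_congr hq _)
  · intro V W hV hW hXV hXW
    refine (hXV.add hXW).congr ?_
    filter_upwards [hV.eventually_diffAlongAt, hW.eventually_diffAlongAt] with q hVq hWq
    rw [covAlong_add hVq hWq]
  · intro a V ha hV hXV
    refine ((hXV.smul ha).add (hV.smul (contMDiffAt_mvfderiv_apply ha hX))).congr ?_
    filter_upwards [hV.eventually_diffAlongAt, (contMDiffAt_iff_contMDiffAt_nhds (by simp)).1
      (ha.of_le (m := 1) (by simp))] with q hVq haq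
    rw [covAlong_smul (haq.mdifferentiableAt (by simp)) hVq]
  · intro U hU
    have hι := hV.contMDiffAt
    have hdι : SmoothAlongAt E ι (fun q ↦ mfderiv% ι q (X q)) p := contMDiffAt_mfderiv_apply hι hX
    refine (hdι.leviCivita_comp hU).congr ?_
    filter_upwards [hι.continuousAt.eventually (eventually_mdifferentiableAt hU),
      (contMDiffAt_iff_contMDiffAt_nhds (by simp)).1 (hι.of_le (m := 1) (by simp))]
      with q hUq hιq
    rw [covAlong_comp (hιq.mdifferentiableAt (by simp)) hUq]

end SmoothAlong

section Torsion

variable {F : Type*} [NormedAddCommGroup F] [NormedSpace ℝ F]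
  {N : Type*} [TopologicalSpace N] [ChartedSpace F N]

lemma trivializationAt_tangentBundle_snd_eq_mvfderiv [IsManifold 𝓘(ℝ, F) 1 N] {x y : N}
    (hy : y ∈ (chartAt F x).source) (w : TangentSpace 𝓘(ℝ, F) y) :
    (trivializationAt F (fun x : N ↦ TangentSpace 𝓘(ℝ, F) x) x ⟨y, w⟩).2 =
      mvfderiv 𝓘(ℝ, F) (extChartAt 𝓘(ℝ, F) x) y w := by
  have hbase : y ∈ (trivializationAt F (fun x : N ↦ TangentSpace 𝓘(ℝ, F) x) x).baseSet := by
    simpa using hy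
  rw [← Trivialization.continuousLinearMapAt_apply_of_mem (R := ℝ) _ hbase,
    TangentBundle.continuousLinearMapAt_trivializationAt (I := 𝓘(ℝ, F)) hy]
  rfl

variable [IsManifold 𝓘(ℝ, F) ∞ N]

variable {E : Type*} [NormedAddCommGroup E] [NormedSpace ℝ E]
  {M : Type*} [TopologicalSpace M] [ChartedSpace E M] [IsManifold 𝓘(ℝ, E) ∞ M]
  {ι : M → N} {p : M} {X Y : Π x : M, TangentSpace 𝓘(ℝ, E) x}

lemma principalPart_mfderiv_eventuallyEq (hι : CMDiffAt ∞ ι p) :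
    principalPart ι (fun q ↦ mfderiv% ι q (Y q)) p =ᶠ[𝓝 p]
      fun q ↦ mvfderiv 𝓘(ℝ, E) (extChartAt 𝓘(ℝ, F) (ι p) ∘ ι) q (Y q) := by
  filter_upwards [hι.continuousAt.eventually (chart_source_mem_nhds F (ι p)),
    (contMDiffAt_iff_contMDiffAt_nhds (n := 1) (by simp)).1 (hι.of_le (by simp))] with q hq hιq
  rw [principalPart, trivializationAt_tangentBundle_snd_eq_mvfderiv hq]
  exact (mvfderiv_comp_vector_apply (mdifferentiableAt_extChartAt hq)
    (hιq.mdifferentiableAt (by simp)) (Y q)).symm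

variable [CompleteSpace F]

lemma mlieBracket_extend {x : N} (v w : TangentSpace 𝓘(ℝ, F) x) :
    mlieBracket 𝓘(ℝ, F) (FiberBundle.extend F v) (FiberBundle.extend F w) x = 0 := by
  set t := trivializationAt F (fun x : N ↦ TangentSpace 𝓘(ℝ, F) x) x
  have hconst (v : TangentSpace 𝓘(ℝ, F) x) : (fun y ↦ mvfderiv 𝓘(ℝ, F) (extChartAt 𝓘(ℝ, F) x) y
      (FiberBundle.extend F v y)) =ᶠ[𝓝 x] fun _ ↦ (t ⟨x, v⟩).2 := by
    filter_upwards [chart_source_mem_nhds F x] with y hy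
    rw [← trivializationAt_tangentBundle_snd_eq_mvfderiv hy]
    have hsymm := congrArg Prod.snd (t.apply_mk_symm (by simpa [t] using hy) (t ⟨x, v⟩).2)
    exact hsymm
  rw [← mvfderiv_extChartAt_self (mlieBracket _ _ _ x), mvfderiv_apply_mlieBracket
    contMDiffAt_extChartAt (FiberBundle.mdifferentiableAt_extend 𝓘(ℝ, F) F v)
    (FiberBundle.mdifferentiableAt_extend 𝓘(ℝ, F) F w), mvfderiv_congr (hconst v),
    mvfderiv_congr (hconst w), mvfderiv_const, mvfderiv_const]
  exact sub_self 0

variable [FiniteDimensional ℝ F] [RiemannianBundle (fun x : N ↦ TangentSpace 𝓘(ℝ, F) x)]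
  [IsContMDiffRiemannianBundle 𝓘(ℝ, F) ∞ F (fun x : N ↦ TangentSpace 𝓘(ℝ, F) x)]

lemma connectionForm_leviCivita_comm {x : N} (v w : TangentSpace 𝓘(ℝ, F) x) :
    connectionForm (leviCivita F N) x v w = connectionForm (leviCivita F N) x w v := by
  have h := (CovariantDerivative.torsion_eq_zero_iff _).1 (leviCivita_torsion (E := F) (M := N))
    (FiberBundle.mdifferentiableAt_extend 𝓘(ℝ, F) F w)
    (FiberBundle.mdifferentiableAt_extend 𝓘(ℝ, F) F v)
  rw [mlieBracket_extend, sub_eq_zero] at h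
  simpa only [connectionForm_apply, FiberBundle.extend_apply_self] using h

variable [CompleteSpace E]

theorem covAlong_torsion (hι : CMDiffAt ∞ ι p) (hX : MDiffAt (T% X) p) (hY : MDiffAt (T% Y) p) :
    covAlong ι (fun q ↦ mfderiv% ι q (Y q)) p (X p) -
        covAlong ι (fun q ↦ mfderiv% ι q (X q)) p (Y p) =
      mfderiv% ι p (mlieBracket 𝓘(ℝ, E) X Y p) := by
  have hφ : CMDiffAt 2 (extChartAt 𝓘(ℝ, F) (ι p) ∘ ι) p :=
    contMDiffAt_extChartAt.comp p (hι.of_le ENat.LEInfty.out)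
  rw [covAlong_eq, covAlong_eq, connectionForm_leviCivita_comm, add_sub_add_right_eq_sub,
    mvfderiv_congr (principalPart_mfderiv_eventuallyEq hι),
    mvfderiv_congr (principalPart_mfderiv_eventuallyEq hι), ← map_sub,
    ← mvfderiv_apply_mlieBracket hφ hX hY]
  refine (congrArg _ ?_).trans
    (symmL_principalPart ι (fun q ↦ mfderiv% ι q (mlieBracket 𝓘(ℝ, E) X Y q)) p)
  exact (principalPart_mfderiv_eventuallyEq hι).self_of_nhds.symm

end Torsion

section Gauss

variable {E : Type*} [NormedAddCommGroup E] [NormedSpace ℝ E]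
  {M : Type*} [TopologicalSpace M] [ChartedSpace E M] [IsManifold 𝓘(ℝ, E) ∞ M]
  [RiemannianBundle (fun x : M ↦ TangentSpace 𝓘(ℝ, E) x)]
  {F : Type*} [NormedAddCommGroup F] [NormedSpace ℝ F] [FiniteDimensional ℝ F]
  [CompleteSpace F]
  {N : Type*} [TopologicalSpace N] [ChartedSpace F N] [IsManifold 𝓘(ℝ, F) ∞ N]
  [RiemannianBundle (fun x : N ↦ TangentSpace 𝓘(ℝ, F) x)]
  [IsContMDiffRiemannianBundle 𝓘(ℝ, F) ∞ F (fun x : N ↦ TangentSpace 𝓘(ℝ, F) x)]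
  {ι : M → N} {p : M} {X Y Z : Π x : M, TangentSpace 𝓘(ℝ, E) x}

lemma IsIsometricImmersion.mvfderiv_metric (hι : IsIsometricImmersion E F ι)
    (hX : CMDiffAt ∞ (T% X) p) (hY : CMDiffAt ∞ (T% Y) p) (v : TangentSpace 𝓘(ℝ, E) p) :
    mvfderiv 𝓘(ℝ, E) (metric X Y) p v =
      inner ℝ (covAlong ι (fun q ↦ mfderiv% ι q (X q)) p v) (mfderiv% ι p (Y p)) +
        inner ℝ (mfderiv% ι p (X p)) (covAlong ι (fun q ↦ mfderiv% ι q (Y q)) p v) := by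
  rw [← mvfderiv_inner_along (contMDiffAt_mfderiv_apply (hι.smooth p) hX)
    (contMDiffAt_mfderiv_apply (hι.smooth p) hY)]
  simp only [hι.isometric]
  rfl

variable [FiniteDimensional ℝ E] [CompleteSpace E]
  [IsContMDiffRiemannianBundle 𝓘(ℝ, E) ∞ E (fun x : M ↦ TangentSpace 𝓘(ℝ, E) x)]

/-- Both sides satisfy the Koszul formula. -/
theorem IsIsometricImmersion.inner_covAlong_mfderiv (hι : IsIsometricImmersion E F ι)
    (hX : CMDiffAt ∞ (T% X) p) (hY : CMDiffAt ∞ (T% Y) p) (hZ : CMDiffAt ∞ (T% Z) p) :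
    inner ℝ (covAlong ι (fun q ↦ mfderiv% ι q (Y q)) p (X p)) (mfderiv% ι p (Z p)) =
      inner ℝ (leviCivita E M Y p (X p)) (Z p) := by
  have hd {A : Π x : M, TangentSpace 𝓘(ℝ, E) x} (hA : CMDiffAt ∞ (T% A) p) : MDiffAt (T% A) p :=
    hA.mdifferentiableAt (by simp)
  have htorsion {A B C : Π x : M, TangentSpace 𝓘(ℝ, E) x} (hA : CMDiffAt ∞ (T% A) p)
      (hB : CMDiffAt ∞ (T% B) p) :
      inner ℝ (C p) (mlieBracket 𝓘(ℝ, E) A B p) =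
        inner ℝ (mfderiv% ι p (C p)) (covAlong ι (fun q ↦ mfderiv% ι q (B q)) p (A p)) -
          inner ℝ (mfderiv% ι p (C p)) (covAlong ι (fun q ↦ mfderiv% ι q (A q)) p (B p)) := by
    rw [← inner_sub_right, covAlong_torsion (hι.smooth p) (hd hA) (hd hB), hι.isometric]
  have hkoszul : inner ℝ (leviCivita E M Y p (X p)) (Z p) = 1 / 2 * koszul Y X Z p :=
    inner_leviCivitaFun (hd hX) (hd hY) (hd hZ)
  rw [hkoszul, koszul, hι.mvfderiv_metric hY hZ, hι.mvfderiv_metric hZ hX,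
    hι.mvfderiv_metric hX hY, htorsion (C := Y) hX hZ, htorsion (C := Z) hY hX,
    htorsion (C := X) hZ hY]
  simp only [fun A : Π x : M, TangentSpace 𝓘(ℝ, E) x ↦ real_inner_comm (mfderiv% ι p (A p))]
  ring

end Gauss

section NormalPart

variable {E : Type*} [NormedAddCommGroup E] [NormedSpace ℝ E]
  {M : Type*} [TopologicalSpace M] [ChartedSpace E M]
  {F : Type*} [NormedAddCommGroup F] [NormedSpace ℝ F]
  {N : Type*} [TopologicalSpace N] [ChartedSpace F N] {ι : M → N} {p : M}

lemma mfderiv_mem_tangentImage (v : TangentSpace 𝓘(ℝ, E) p) :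
    (mfderiv% ι p v : TangentSpace 𝓘(ℝ, F) (ι p)) ∈ tangentImage E ι p :=
  ⟨v, rfl⟩

variable [FiniteDimensional ℝ F] [RiemannianBundle (fun x : N ↦ TangentSpace 𝓘(ℝ, F) x)]
  {v w : TangentSpace 𝓘(ℝ, F) (ι p)}

lemma isLinearMap_normalPart : IsLinearMap ℝ (normalPart (F := F) E ι p) :=
  ⟨fun v w ↦ map_add _ v w, fun a v ↦ map_smul _ a v⟩

lemma normalPart_mem_orthogonal : normalPart E ι p v ∈ (tangentImage E ι p)ᗮ :=
  Submodule.starProjection_apply_mem _ _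

lemma normalPart_eq_zero_iff : normalPart E ι p v = 0 ↔ v ∈ tangentImage E ι p := by
  rw [normalPart, Submodule.starProjection_apply_eq_zero_iff, Submodule.orthogonal_orthogonal]

lemma normalPart_eq_self (hv : v ∈ (tangentImage E ι p)ᗮ) : normalPart E ι p v = v :=
  Submodule.starProjection_eq_self_iff.2 hv

lemma inner_normalPart (hw : w ∈ (tangentImage E ι p)ᗮ) :
    inner ℝ (normalPart E ι p v) w = inner ℝ v w := by
  rw [normalPart, Submodule.inner_starProjection_left_eq_right,
    Submodule.starProjection_eq_self_iff.2 hw]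

end NormalPart

open InnerProductSpace in
lemma sum_apply_orthonormalBasis_self {κ A B : Type*} [Fintype κ] [NormedAddCommGroup A]
    [InnerProductSpace ℝ A] [FiniteDimensional ℝ A] [AddCommGroup B] [Module ℝ B]
    (β : A →ₗ[ℝ] A →ₗ[ℝ] B) (b : OrthonormalBasis κ ℝ A) :
    ∑ i, β (b i) (b i) = TensorProduct.lift β (canonicalCovariantTensor A) := by
  simp only [canonicalCovariantTensor_eq_sum A b, map_sum, TensorProduct.lift.tmul]

section SecondFundamentalForm

variable {E : Type*} [NormedAddCommGroup E] [NormedSpace ℝ E]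
  {M : Type*} [TopologicalSpace M] [ChartedSpace E M]
  {F : Type*} [NormedAddCommGroup F] [NormedSpace ℝ F] [FiniteDimensional ℝ F] [CompleteSpace F]
  {N : Type*} [TopologicalSpace N] [ChartedSpace F N] [IsManifold 𝓘(ℝ, F) ∞ N]
  [RiemannianBundle (fun x : N ↦ TangentSpace 𝓘(ℝ, F) x)]
  [IsContMDiffRiemannianBundle 𝓘(ℝ, F) ∞ F (fun x : N ↦ TangentSpace 𝓘(ℝ, F) x)]
  {ι : M → N} {p : M} {X Y : Π x : M, TangentSpace 𝓘(ℝ, E) x}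

lemma isLinearMap_covAlong {V : Π p : M, TangentSpace 𝓘(ℝ, F) (ι p)} :
    IsLinearMap ℝ (covAlong (E := E) ι V p) := by
  constructor
  · intro v w
    simp only [covAlong_eq, map_add]
    exact add_add_add_comm _ _ _ _
  · intro a v
    simp only [covAlong_eq, map_smul]
    exact (smul_add _ _ _).symm

lemma secondFundamentalForm_congr_left {X' : Π x : M, TangentSpace 𝓘(ℝ, E) x} (h : X p = X' p) :
    (secondFundamentalForm ι X Y p : TangentSpace 𝓘(ℝ, F) (ι p)) =
      secondFundamentalForm ι X' Y p := by
  rw [secondFundamentalForm, secondFundamentalForm, h]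

variable [IsManifold 𝓘(ℝ, E) ∞ M]

variable (E) in
/-- The second fundamental form at `p` on tangent vectors; the value does not depend on the
extensions of the vectors to fields, see `secondFundamentalForm_eq_secondFundamentalFormAt`. -/
def secondFundamentalFormAt (ι : M → N) (p : M) (v w : TangentSpace 𝓘(ℝ, E) p) :
    TangentSpace 𝓘(ℝ, F) (ι p) :=
  secondFundamentalForm ι (FiberBundle.extend E v) (FiberBundle.extend E w) p

section

variable [CompleteSpace E]

lemma secondFundamentalForm_comm (hι : CMDiffAt ∞ ι p) (hX : MDiffAt (T% X) p)
    (hY : MDiffAt (T% Y) p) :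
    (secondFundamentalForm ι X Y p : TangentSpace 𝓘(ℝ, F) (ι p)) =
      secondFundamentalForm ι Y X p := by
  rw [← sub_eq_zero, secondFundamentalForm, secondFundamentalForm,
    ← isLinearMap_normalPart.map_sub, covAlong_torsion hι hX hY, normalPart_eq_zero_iff]
  exact mfderiv_mem_tangentImage _

lemma secondFundamentalFormAt_comm (hι : CMDiffAt ∞ ι p) (v w : TangentSpace 𝓘(ℝ, E) p) :
    (secondFundamentalFormAt E ι p v w : TangentSpace 𝓘(ℝ, F) (ι p)) =
      secondFundamentalFormAt E ι p w v :=
  secondFundamentalForm_comm hι (FiberBundle.mdifferentiableAt_extend 𝓘(ℝ, E) E v)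
    (FiberBundle.mdifferentiableAt_extend 𝓘(ℝ, E) E w)

lemma secondFundamentalForm_eq_secondFundamentalFormAt (hι : CMDiffAt ∞ ι p)
    (hY : MDiffAt (T% Y) p) :
    (secondFundamentalForm ι X Y p : TangentSpace 𝓘(ℝ, F) (ι p)) =
      secondFundamentalFormAt E ι p (X p) (Y p) := by
  have hX := FiberBundle.mdifferentiableAt_extend 𝓘(ℝ, E) E (X p)
  rw [secondFundamentalForm_congr_left (X' := FiberBundle.extend E (X p)) (by simp),
    secondFundamentalForm_comm hι hX hY,
    secondFundamentalForm_congr_left (X' := FiberBundle.extend E (Y p)) (by simp)]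
  exact secondFundamentalFormAt_comm hι _ _

end

lemma isLinearMap_secondFundamentalFormAt (w : TangentSpace 𝓘(ℝ, E) p) :
    IsLinearMap ℝ (fun v ↦ secondFundamentalFormAt (F := F) E ι p v w) := by
  constructor
  · intro v v'
    simp only [secondFundamentalFormAt, secondFundamentalForm, FiberBundle.extend_apply_self,
      isLinearMap_covAlong.map_add, isLinearMap_normalPart.map_add]
  · intro a v
    simp only [secondFundamentalFormAt, secondFundamentalForm, FiberBundle.extend_apply_self,
      isLinearMap_covAlong.map_smul, isLinearMap_normalPart.map_smul]

variable [CompleteSpace E]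

/-- The second fundamental form at `p` as a bilinear map, through which its trace is expressed. -/
def secondFundamentalFormBilin (hι : CMDiffAt ∞ ι p) :
    TangentSpace 𝓘(ℝ, E) p →ₗ[ℝ] TangentSpace 𝓘(ℝ, E) p →ₗ[ℝ] TangentSpace 𝓘(ℝ, F) (ι p) :=
  LinearMap.mk₂ ℝ (secondFundamentalFormAt E ι p)
    (fun v v' w ↦ (isLinearMap_secondFundamentalFormAt w).map_add v v')
    (fun a v w ↦ (isLinearMap_secondFundamentalFormAt w).map_smul a v)
    (fun v w w' ↦ by
      simp only [secondFundamentalFormAt_comm hι v]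
      exact (isLinearMap_secondFundamentalFormAt v).map_add w w')
    (fun a v w ↦ by
      simp only [secondFundamentalFormAt_comm hι v]
      exact (isLinearMap_secondFundamentalFormAt v).map_smul a w)

variable [FiniteDimensional ℝ E] [RiemannianBundle (fun x : M ↦ TangentSpace 𝓘(ℝ, E) x)]

lemma meanCurvature_eq_sum {κ : Type*} [Fintype κ] (hι : CMDiffAt ∞ ι p)
    (b : OrthonormalBasis κ ℝ (TangentSpace 𝓘(ℝ, E) p)) :
    meanCurvature E F ι p =
      (finrank ℝ E : ℝ)⁻¹ • ∑ i, secondFundamentalFormAt E ι p (b i) (b i) := by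
  have htrace := (sum_apply_orthonormalBasis_self (secondFundamentalFormBilin hι)
    (stdOrthonormalBasis ℝ _)).trans
      (sum_apply_orthonormalBasis_self (secondFundamentalFormBilin hι) b).symm
  exact congrArg _ htrace

variable [IsContMDiffRiemannianBundle 𝓘(ℝ, E) ∞ E (fun x : M ↦ TangentSpace 𝓘(ℝ, E) x)]

lemma contMDiffAt_inner_meanCurvature {ξ : Π p : M, TangentSpace 𝓘(ℝ, F) (ι p)}
    (hι : IsIsometricImmersion E F ι) (hξ : SmoothAlongAt E ι ξ p)
    (hnormal : ∀ q, ξ q ∈ (tangentImage E ι q)ᗮ) :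
    CMDiffAt ∞ (fun q ↦ inner ℝ (meanCurvature E F ι q) (ξ q)) p := by
  obtain ⟨s, hs⟩ :=
    exists_contMDiffAt_orthonormalBasis 𝓘(ℝ, E) ∞ E (fun x : M ↦ TangentSpace 𝓘(ℝ, E) x) p
  have hsp := hs.self_of_nhds.1
  have hsmooth : CMDiffAt ∞ (fun q ↦ (finrank ℝ E : ℝ)⁻¹ *
      ∑ i, inner ℝ (covAlong ι (fun q ↦ mfderiv% ι q (s i q)) q (s i q)) (ξ q)) p :=
    contMDiffAt_const.mul (ContMDiffAt.sum fun i _ ↦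
      (SmoothAlongAt.covAlong (contMDiffAt_mfderiv_apply (hι.smooth p) (hsp i)) (hsp i)).inner hξ)
  refine hsmooth.congr_of_eventuallyEq ?_
  filter_upwards [hs] with q ⟨hsq, b, hb⟩
  rw [meanCurvature_eq_sum (hι.smooth q) b, real_inner_smul_left, sum_inner]
  refine congrArg _ (Finset.sum_congr rfl fun i _ ↦ ?_)
  rw [hb i, ← secondFundamentalForm_eq_secondFundamentalFormAt (hι.smooth q)
    ((hsq i).mdifferentiableAt (by simp)), secondFundamentalForm, inner_normalPart (hnormal q)]

theorem IsIsometricImmersion.gauss_formula (hι : IsIsometricImmersion E F ι)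
    (hX : CMDiffAt ∞ (T% X) p) (hY : CMDiffAt ∞ (T% Y) p) :
    covAlong ι (fun q ↦ mfderiv% ι q (Y q)) p (X p) =
      mfderiv% ι p (leviCivita E M Y p (X p)) + secondFundamentalForm ι X Y p := by
  set A := covAlong ι (fun q ↦ mfderiv% ι q (Y q)) p (X p)
  set B : TangentSpace 𝓘(ℝ, F) (ι p) := mfderiv% ι p (leviCivita E M Y p (X p))
  have hperp : A - B ∈ (tangentImage E ι p)ᗮ := by
    rw [Submodule.mem_orthogonal']
    rintro _ ⟨w, rfl⟩
    have hGauss := hι.inner_covAlong_mfderiv hX hY (FiberBundle.contMDiffAt_extend 𝓘(ℝ, E) E w)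
    rw [FiberBundle.extend_apply_self] at hGauss
    rw [inner_sub_left, sub_eq_zero]
    exact hGauss.trans (hι.isometric p _ _).symm
  have hB : normalPart E ι p B = 0 := normalPart_eq_zero_iff.2 (mfderiv_mem_tangentImage _)
  have hσ : secondFundamentalForm ι X Y p = A - B := by
    rw [← normalPart_eq_self hperp, isLinearMap_normalPart.map_sub, hB, sub_zero]
    rfl
  rw [hσ, add_sub_cancel]

end SecondFundamentalForm

section Kaehler

variable {E : Type*} [NormedAddCommGroup E] [NormedSpace ℝ E]
  {M : Type*} [TopologicalSpace M] [ChartedSpace E M]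
  {F : Type*} [NormedAddCommGroup F] [NormedSpace ℝ F] [FiniteDimensional ℝ F] [CompleteSpace F]
  {N : Type*} [TopologicalSpace N] [ChartedSpace F N] [IsManifold 𝓘(ℝ, F) ∞ N]
  [RiemannianBundle (fun x : N ↦ TangentSpace 𝓘(ℝ, F) x)]
  [IsContMDiffRiemannianBundle 𝓘(ℝ, F) ∞ F (fun x : N ↦ TangentSpace 𝓘(ℝ, F) x)]
  {ι : M → N} {p : M} {J : Π x : N, TangentSpace 𝓘(ℝ, F) x →L[ℝ] TangentSpace 𝓘(ℝ, F) x}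

lemma IsKaehler.inner_apply_left (hJ : IsKaehler J) {x : N} (v w : TangentSpace 𝓘(ℝ, F) x) :
    inner ℝ (J x v) w = -inner ℝ v (J x w) := by
  rw [← hJ.isometric, hJ.sq, inner_neg_left]

lemma IsKaehler.normalPart_apply_apply (hJ : IsKaehler J) {v : TangentSpace 𝓘(ℝ, F) (ι p)}
    (hv : v ∈ tangentImage E ι p) : normalPart E ι p (J (ι p) (J (ι p) v)) = 0 := by
  rw [hJ.sq]
  exact normalPart_eq_zero_iff.2 (neg_mem hv)

lemma IsKaehler.normalPart_apply_eq_zero (hJ : IsKaehler J) {v : TangentSpace 𝓘(ℝ, F) (ι p)}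
    (hv : v ∈ (tangentImage E ι p)ᗮ)
    (h : normalPart E ι p (J (ι p) (normalPart E ι p (J (ι p) v))) = 0) :
    normalPart E ι p (J (ι p) v) = 0 := by
  set w := normalPart E ι p (J (ι p) v)
  have hJw : inner ℝ (J (ι p) w) v = 0 := by rw [← inner_normalPart hv, h, inner_zero_left]
  have hw : inner ℝ w w = 0 := by
    rw [inner_normalPart normalPart_mem_orthogonal, hJ.inner_apply_left, real_inner_comm, hJw,
      neg_zero]
  exact inner_self_eq_zero.1 hw

lemma covAlong_zero (hι : MDiffAt ι p) (v : TangentSpace 𝓘(ℝ, E) p) :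
    covAlong ι (fun q ↦ (0 : TangentSpace 𝓘(ℝ, F) (ι q))) p v = 0 := by
  have hzero := covAlong_comp (U := 0) hι
    (mdifferentiableAt_zeroSection ℝ (fun x : N ↦ TangentSpace 𝓘(ℝ, F) x)) v
  rwa [CovariantDerivative.zero] at hzero

variable [RiemannianBundle (fun x : M ↦ TangentSpace 𝓘(ℝ, E) x)]

lemma IsKaehler.eq_zero_of_apply_mfderiv (hJ : IsKaehler J) (hι : IsIsometricImmersion E F ι)
    {v : TangentSpace 𝓘(ℝ, E) p}
    (h : J (ι p) (mfderiv% ι p v : TangentSpace 𝓘(ℝ, F) (ι p)) = 0) : v = 0 := by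
  have hv := (hJ.isometric (ι p) _ _).trans (hι.isometric p v v)
  rw [h, inner_zero_left] at hv
  exact inner_self_eq_zero.1 hv.symm

variable [IsManifold 𝓘(ℝ, E) ∞ M]

lemma IsTotallyReal.isSmoothNormalField_apply_mfderiv (hreal : IsTotallyReal E ι J)
    (hJ : IsKaehler J) (hι : IsIsometricImmersion E F ι) {Y : Π x : M, TangentSpace 𝓘(ℝ, E) x}
    (hY : IsSmoothField Y) :
    IsSmoothNormalField E ι (fun q ↦ J (ι q) (mfderiv% ι q (Y q))) where
  smooth q := hJ.smoothAlongAt (contMDiffAt_mfderiv_apply (hι.smooth q) (hY q))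
  normal q := hreal q _ (mfderiv_mem_tangentImage _)

end Kaehler

section Curvature

variable {E : Type*} [NormedAddCommGroup E] [NormedSpace ℝ E] [FiniteDimensional ℝ E]
  [CompleteSpace E]
  {M : Type*} [TopologicalSpace M] [T2Space M] [ChartedSpace E M] [IsManifold 𝓘(ℝ, E) ∞ M]
  [RiemannianBundle (fun x : M ↦ TangentSpace 𝓘(ℝ, E) x)]
  [IsContMDiffRiemannianBundle 𝓘(ℝ, E) ∞ E (fun x : M ↦ TangentSpace 𝓘(ℝ, E) x)]

lemma eq_zero_or_eq_zero_of_curvature_eq_zero (hE : 1 < finrank ℝ E) {p : M} {k : ℝ}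
    {Z : Π x : M, TangentSpace 𝓘(ℝ, E) x}
    (hk : ∀ X : Π x : M, TangentSpace 𝓘(ℝ, E) x, IsSmoothField X →
      inner ℝ (curvature X Z Z p) (X p) =
        k * (inner ℝ (X p) (X p) * inner ℝ (Z p) (Z p) - inner ℝ (X p) (Z p) ^ 2))
    (hR : ∀ X : Π x : M, TangentSpace 𝓘(ℝ, E) x, IsSmoothField X → curvature X Z Z p = 0) :
    Z p = 0 ∨ k = 0 := by
  obtain ⟨v, hv, hvZ⟩ := exists_ne_zero_inner_eq_zero (V := TangentSpace 𝓘(ℝ, E) p) hE (Z p)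
  obtain ⟨X, hX, hXv⟩ := exists_isSmoothField_eventuallyEq_extend v
  have hXp : X p = v := by rw [hXv.self_of_nhds, FiberBundle.extend_apply_self]
  have hsec := hk X hX
  rw [hR X hX, hXp, hvZ, inner_zero_left] at hsec
  simpa [hv, or_comm] using hsec.symm

end Curvature

section TotallyRealSubmanifold

variable {E : Type*} [NormedAddCommGroup E] [NormedSpace ℝ E] [FiniteDimensional ℝ E]
  [CompleteSpace E]
  {M : Type*} [TopologicalSpace M] [ChartedSpace E M] [IsManifold 𝓘(ℝ, E) ∞ M]
  [RiemannianBundle (fun x : M ↦ TangentSpace 𝓘(ℝ, E) x)]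
  [IsContMDiffRiemannianBundle 𝓘(ℝ, E) ∞ E (fun x : M ↦ TangentSpace 𝓘(ℝ, E) x)]
  {F : Type*} [NormedAddCommGroup F] [NormedSpace ℝ F] [FiniteDimensional ℝ F] [CompleteSpace F]
  {N : Type*} [TopologicalSpace N] [ChartedSpace F N] [IsManifold 𝓘(ℝ, F) ∞ N]
  [RiemannianBundle (fun x : N ↦ TangentSpace 𝓘(ℝ, F) x)]
  [IsContMDiffRiemannianBundle 𝓘(ℝ, F) ∞ F (fun x : N ↦ TangentSpace 𝓘(ℝ, F) x)]
  {ι : M → N} {p : M} {X Y Z : Π x : M, TangentSpace 𝓘(ℝ, E) x}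
  {J : Π x : N, TangentSpace 𝓘(ℝ, F) x →L[ℝ] TangentSpace 𝓘(ℝ, F) x}

lemma IsKaehler.covAlong_apply_mfderiv (hJ : IsKaehler J) (hι : IsIsometricImmersion E F ι)
    (hX : CMDiffAt ∞ (T% X) p) (hY : CMDiffAt ∞ (T% Y) p) :
    covAlong ι (fun q ↦ J (ι q) (mfderiv% ι q (Y q))) p (X p) =
      J (ι p) (mfderiv% ι p (leviCivita E M Y p (X p))) +
        J (ι p) (secondFundamentalForm ι X Y p) := by
  rw [hJ.covAlong_apply (contMDiffAt_mfderiv_apply (hι.smooth p) hY), hι.gauss_formula hX hY,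
    map_add]

lemma IsTotallyReal.normalCov_apply_mfderiv (hreal : IsTotallyReal E ι J) (hJ : IsKaehler J)
    (hι : IsIsometricImmersion E F ι) (hX : CMDiffAt ∞ (T% X) p) (hY : CMDiffAt ∞ (T% Y) p) :
    normalCov ι X (fun q ↦ J (ι q) (mfderiv% ι q (Y q))) p =
      J (ι p) (mfderiv% ι p (leviCivita E M Y p (X p))) +
        normalPart E ι p (J (ι p) (secondFundamentalForm ι X Y p)) := by
  rw [normalCov, hJ.covAlong_apply_mfderiv hι hX hY, isLinearMap_normalPart.map_add,
    normalPart_eq_self (hreal p _ (mfderiv_mem_tangentImage _))]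

/-- Since `J dι Y` is normal and `f (J dι Y) = 0`, `Df = 0` gives `f (f σ(X, Y)) = 0`, and `f` is
skew. -/
theorem HasParallelFStructure.normalPart_apply_secondFundamentalForm
    (hf : HasParallelFStructure E ι J) (hreal : IsTotallyReal E ι J) (hJ : IsKaehler J)
    (hι : IsIsometricImmersion E F ι) (hX : IsSmoothField X) (hY : IsSmoothField Y) :
    normalPart E ι p (J (ι p) (secondFundamentalForm ι X Y p)) = 0 := by
  have hfJ : fStructure E ι J (fun q ↦ J (ι q) (mfderiv% ι q (Y q))) =
      fun q ↦ (0 : TangentSpace 𝓘(ℝ, F) (ι q)) :=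
    funext fun q ↦ hJ.normalPart_apply_apply (mfderiv_mem_tangentImage _)
  have hDf := hf X hX _ (hreal.isSmoothNormalField_apply_mfderiv hJ hι hY) p
  rw [hfJ, normalCov, covAlong_zero ((hι.smooth p).mdifferentiableAt (by simp)),
    isLinearMap_normalPart.map_zero, fStructure, hreal.normalCov_apply_mfderiv hJ hι (hX p) (hY p),
    map_add, isLinearMap_normalPart.map_add,
    hJ.normalPart_apply_apply (mfderiv_mem_tangentImage _), zero_add] at hDf
  exact hJ.normalPart_apply_eq_zero normalPart_mem_orthogonal hDf.symm

lemma HasParallelFStructure.normalCov_apply_mfderiv (hf : HasParallelFStructure E ι J)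
    (hreal : IsTotallyReal E ι J) (hJ : IsKaehler J) (hι : IsIsometricImmersion E F ι)
    (hX : IsSmoothField X) (hY : IsSmoothField Y) :
    normalCov ι X (fun q ↦ J (ι q) (mfderiv% ι q (Y q))) =
      fun q ↦ J (ι q) (mfderiv% ι q (leviCivita E M Y q (X q))) := by
  funext q
  rw [hreal.normalCov_apply_mfderiv hJ hι (hX q) (hY q),
    hf.normalPart_apply_secondFundamentalForm hreal hJ hι hX hY, add_zero]

theorem HasParallelFStructure.normalCurvature_apply_mfderiv (hf : HasParallelFStructure E ι J)
    (hreal : IsTotallyReal E ι J) (hJ : IsKaehler J) (hι : IsIsometricImmersion E F ι)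
    (hX : IsSmoothField X) (hY : IsSmoothField Y) (hZ : IsSmoothField Z) :
    normalCurvature ι X Y (fun q ↦ J (ι q) (mfderiv% ι q (Z q))) p =
      J (ι p) (mfderiv% ι p (curvature X Y Z p)) := by
  have hcov {A B : Π x : M, TangentSpace 𝓘(ℝ, E) x} (hA : IsSmoothField A)
      (hB : IsSmoothField B) := hf.normalCov_apply_mfderiv hreal hJ hι hA hB
  have hXZ : IsSmoothField (fun q ↦ leviCivita E M Z q (X q)) :=
    fun q ↦ contMDiffAt_leviCivita (hX q) (hZ q)
  have hYZ : IsSmoothField (fun q ↦ leviCivita E M Z q (Y q)) :=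
    fun q ↦ contMDiffAt_leviCivita (hY q) (hZ q)
  have hXY : IsSmoothField (mlieBracket 𝓘(ℝ, E) X Y) :=
    fun q ↦ contMDiffAt_mlieBracket (hX q) (hY q)
  rw [normalCurvature, hcov hY hZ, hcov hX hZ, hcov hX hYZ, hcov hY hXZ, hcov hXY hZ, curvature,
    map_sub, map_sub, map_sub, map_sub]

variable [T2Space M]

lemma HasParallelFStructure.apply_meanCurvature_mem_tangentImage (hf : HasParallelFStructure E ι J)
    (hreal : IsTotallyReal E ι J) (hJ : IsKaehler J) (hι : IsIsometricImmersion E F ι) (p : M) :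
    J (ι p) (meanCurvature E F ι p) ∈ tangentImage E ι p := by
  have hσ (v w : TangentSpace 𝓘(ℝ, E) p) :
      J (ι p) (secondFundamentalFormAt E ι p v w) ∈ tangentImage E ι p := by
    obtain ⟨X, hX, hXv⟩ := exists_isSmoothField_eventuallyEq_extend v
    obtain ⟨Y, hY, hYw⟩ := exists_isSmoothField_eventuallyEq_extend w
    have hat := secondFundamentalForm_eq_secondFundamentalFormAt (X := X) (hι.smooth p)
      ((hY p).mdifferentiableAt (by simp))
    rw [hXv.self_of_nhds, hYw.self_of_nhds, FiberBundle.extend_apply_self,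
      FiberBundle.extend_apply_self] at hat
    rw [← hat, ← normalPart_eq_zero_iff]
    exact hf.normalPart_apply_secondFundamentalForm hreal hJ hι hX hY
  rw [meanCurvature_eq_sum (hι.smooth p) (stdOrthonormalBasis ℝ _), map_smul, map_sum]
  exact Submodule.smul_mem _ _ (Submodule.sum_mem _ fun i _ ↦ hσ _ _)

theorem HasParallelFStructure.exists_meanCurvature_eq_apply_mfderiv
    (hf : HasParallelFStructure E ι J) (hreal : IsTotallyReal E ι J) (hJ : IsKaehler J)
    (hι : IsIsometricImmersion E F ι) :
    ∃ Z : Π x : M, TangentSpace 𝓘(ℝ, E) x, IsSmoothField Z ∧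
      meanCurvature E F ι = fun q ↦ J (ι q) (mfderiv% ι q (Z q)) := by
  choose Z hZ using fun q ↦ neg_mem (hf.apply_meanCurvature_mem_tangentImage hreal hJ hι q)
  refine ⟨Z, fun p ↦ contMDiffAt_section_of_inner (V := fun x : M ↦ TangentSpace 𝓘(ℝ, E) x)
    fun X hX ↦ ?_, funext fun q ↦ ?_⟩
  · have hsmooth := contMDiffAt_inner_meanCurvature hι
      (hJ.smoothAlongAt (contMDiffAt_mfderiv_apply (hι.smooth p) hX))
      (fun q ↦ hreal q _ (mfderiv_mem_tangentImage _))
    refine hsmooth.congr_of_eventuallyEq (.of_forall fun q ↦ ?_)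
    calc inner ℝ (X q) (Z q)
        = inner ℝ (mfderiv% ι q (Z q) : TangentSpace 𝓘(ℝ, F) (ι q)) (mfderiv% ι q (X q)) := by
          rw [real_inner_comm, hι.isometric]
      _ = inner ℝ (-J (ι q) (meanCurvature E F ι q)) (mfderiv% ι q (X q)) := by rw [← hZ q]; rfl
      _ = inner ℝ (meanCurvature E F ι q) (J (ι q) (mfderiv% ι q (X q))) := by
          rw [inner_neg_left, hJ.inner_apply_left, neg_neg]
  · refine Eq.symm ((congrArg (J (ι q)) (hZ q)).trans ?_)
    rw [map_neg, hJ.sq, neg_neg]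

end TotallyRealSubmanifold

end TotallyReal

end

theorem proposition1_general {E : Type*} [NormedAddCommGroup E] [NormedSpace ℝ E]
    [FiniteDimensional ℝ E] [CompleteSpace E] (hE : 1 < finrank ℝ E)
    {M : Type*} [TopologicalSpace M] [T2Space M] [ChartedSpace E M] [IsManifold 𝓘(ℝ, E) ∞ M]
    [RiemannianBundle (fun p : M ↦ TangentSpace 𝓘(ℝ, E) p)]
    [IsContMDiffRiemannianBundle 𝓘(ℝ, E) ∞ E (fun p : M ↦ TangentSpace 𝓘(ℝ, E) p)]
    {F : Type*} [NormedAddCommGroup F] [NormedSpace ℝ F] [FiniteDimensional ℝ F] [CompleteSpace F]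
    {N : Type*} [TopologicalSpace N] [ChartedSpace F N] [IsManifold 𝓘(ℝ, F) ∞ N]
    [RiemannianBundle (fun x : N ↦ TangentSpace 𝓘(ℝ, F) x)]
    [IsContMDiffRiemannianBundle 𝓘(ℝ, F) ∞ F (fun x : N ↦ TangentSpace 𝓘(ℝ, F) x)]
    {J : Π x : N, TangentSpace 𝓘(ℝ, F) x →L[ℝ] TangentSpace 𝓘(ℝ, F) x}
    (hJ : TotallyReal.IsKaehler J) {ι : M → N} (hι : TotallyReal.IsIsometricImmersion E F ι)
    (hreal : TotallyReal.IsTotallyReal E ι J) (hf : TotallyReal.HasParallelFStructure E ι J)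
    (hH : TotallyReal.HasSemiparallelMeanCurvature E F ι) (p : M) {k : ℝ}
    (hk : ∀ X Y : Π x : M, TangentSpace 𝓘(ℝ, E) x,
      TotallyReal.IsSmoothField X → TotallyReal.IsSmoothField Y →
        inner ℝ (TotallyReal.curvature X Y Y p) (X p) =
          k * (inner ℝ (X p) (X p) * inner ℝ (Y p) (Y p) - inner ℝ (X p) (Y p) ^ 2)) :
    TotallyReal.meanCurvature E F ι p = 0 ∨ k = 0 := by
  obtain ⟨Z, hZ, hHZ⟩ := hf.exists_meanCurvature_eq_apply_mfderiv hreal hJ hι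
  have hRZ (X : Π x : M, TangentSpace 𝓘(ℝ, E) x) (hX : TotallyReal.IsSmoothField X) :
      TotallyReal.curvature X Z Z p = 0 := by
    have hRH := hH X Z hX hZ p
    rw [hHZ, hf.normalCurvature_apply_mfderiv hreal hJ hι hX hZ hZ] at hRH
    exact hJ.eq_zero_of_apply_mfderiv hι hRH
  refine (TotallyReal.eq_zero_or_eq_zero_of_curvature_eq_zero hE (fun X hX ↦ hk X Z hX hZ)
    hRZ).imp_left fun hZp ↦ ?_
  simp only [hHZ, hZp, map_zero]

theorem proposition1 {n m : ℕ} (hn : 1 < n)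
    {M : Type*} [TopologicalSpace M] [T2Space M] [ChartedSpace (EuclideanSpace ℝ (Fin n)) M]
    [IsManifold 𝓘(ℝ, EuclideanSpace ℝ (Fin n)) ∞ M]
    [RiemannianBundle (fun p : M ↦ TangentSpace 𝓘(ℝ, EuclideanSpace ℝ (Fin n)) p)]
    [IsContMDiffRiemannianBundle 𝓘(ℝ, EuclideanSpace ℝ (Fin n)) ∞ (EuclideanSpace ℝ (Fin n))
      (fun p : M ↦ TangentSpace 𝓘(ℝ, EuclideanSpace ℝ (Fin n)) p)]
    {N : Type*} [TopologicalSpace N] [T2Space N] [ChartedSpace (EuclideanSpace ℝ (Fin (2 * m))) N]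
    [IsManifold 𝓘(ℝ, EuclideanSpace ℝ (Fin (2 * m))) ∞ N]
    [RiemannianBundle (fun x : N ↦ TangentSpace 𝓘(ℝ, EuclideanSpace ℝ (Fin (2 * m))) x)]
    [IsContMDiffRiemannianBundle 𝓘(ℝ, EuclideanSpace ℝ (Fin (2 * m))) ∞
      (EuclideanSpace ℝ (Fin (2 * m)))
      (fun x : N ↦ TangentSpace 𝓘(ℝ, EuclideanSpace ℝ (Fin (2 * m))) x)]
    (J : Π x : N, TangentSpace 𝓘(ℝ, EuclideanSpace ℝ (Fin (2 * m))) x →L[ℝ]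
      TangentSpace 𝓘(ℝ, EuclideanSpace ℝ (Fin (2 * m))) x)
    (hJ : TotallyReal.IsKaehler J)
    (ι : M → N)
    (hι : TotallyReal.IsIsometricImmersion (EuclideanSpace ℝ (Fin n))
      (EuclideanSpace ℝ (Fin (2 * m))) ι)
    (hreal : TotallyReal.IsTotallyReal (EuclideanSpace ℝ (Fin n)) ι J)
    (hf : TotallyReal.HasParallelFStructure (EuclideanSpace ℝ (Fin n)) ι J)
    (c : ℝ) (hc : TotallyReal.HasConstantCurvature (EuclideanSpace ℝ (Fin n)) M c)
    (hH : TotallyReal.HasSemiparallelMeanCurvature (EuclideanSpace ℝ (Fin n))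
      (EuclideanSpace ℝ (Fin (2 * m))) ι) :
    TotallyReal.IsMinimal (EuclideanSpace ℝ (Fin n)) (EuclideanSpace ℝ (Fin (2 * m))) ι ∨
      TotallyReal.IsFlat (EuclideanSpace ℝ (Fin n)) M := by
  refine (eq_or_ne c 0).symm.imp (fun hc0 p ↦ ?_) (by rintro rfl; exact hc)
  exact (proposition1_general (by simpa using hn) hJ hι hreal hf hH p
    fun X Y hX hY ↦ hc X Y hX hY p).resolve_right hc0
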